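/- Let $\omega_1,\omega_2,\omega_3\in\mathbb R$ be pairwise distinct and write $\omega_{ij}=\omega_i-\omega_j$. For real $\epsilon\ne0$ the discrete Clebsch system is the birational map $f(m,p,\epsilon)=M(m,p,\epsilon)^{-1}\binom mp$ of $\mathbb R^6\ni(m,p)=(m_1,m_2,m_3,p_1,p_2,p_3)$, defined where $\det M(m,p,\epsilon)\neq0$, with $$M(m,p,\epsilon)=\begin{pmatrix}1&0&0&0&\epsilon\omega_{23}p_3&\epsilon\omega_{23}p_2\\0&1&0&\epsilon\omega_{31}p_3&0&\epsilon\omega_{31}p_1\\0&0&1&\epsilon\omega_{12}p_2&\epsilon\omega_{12}p_1&0\\0&\epsilon p_3&-\epsilon p_2&1&-\epsilon m_3&\epsilon m_2\\-\epsilon p_3&0&\epsilon p_1&\epsilon m_3&1&-\epsilon m_1\\\epsilon p_2&-\epsilon p_1&0&-\epsilon m_2&\epsilon m_1&1\end{pmatrix};$$ its inverse is $f(\cdot,-\epsilon)$. For a tuple of functions $\Phi=(\varphi_1,\dots,\varphi_l)$ on $\mathbb R^6$ and a point $x$, the null-space $K_\Phi(x)\subset\mathbb R^l$ is the set of all $c$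 with $c_1\varphi_1(f^i(x))+\dots+c_l\varphi_l(f^i(x))=0$ for all $i\in\mathbb Z$ for which $f^i(x)$ is defined. $\Phi$ is an HK-basis (Hirota–Kimura basis) if $\varphi_1,\dots,\varphi_l$ are linearly independent over $\mathbb R$ and $K_\Phi(x)\neq0$ for every $x\in\mathbb R^6$. A function $h$ defined on a subset of $\mathbb R^6$ is an integral if $h(f(x))=h(x)$ whenever $f(x)$, $h(x)$ and $h(f(x))$ are defined. Put $H_1=\sum_k(m_k^2+\omega_kp_k^2)$, $H_3=p_1^2+p_2^2+p_3^2$, $H_4=m_1p_1+m_2p_2+m_3p_3$ and, for $(k,i,j)$ a cyclic permutation of $(1,2,3)$, $$d^{(2)}_{6+k}=m_1^2+m_2^2+m_3^2+(\omega_i+\omega_j-2\omega_k)p_k^2+(\omega_j-\omega_i)p_i^2+(\omega_i-\omega_j)p_j^2 .$$ **Theorem.** There are polynomials in the phase variables $(m,p)$, with coefficients independent of $\epsilon$: $\Delta^{(6)},\Delta^{(8)}$, and $d_k^{(4)},d_k^{(6)}$ $(k=7,8,9)$, and $g_k^{(6)},g_k^{(8)},g_k^{(10)}$ $(k=1,2,3)$,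 each homogeneous of the degree given by its upper index, such that the following holds with $$\Delta=H_4+\epsilon^2\sum_{k=1}^3m_kp_k\,d^{(2)}_{6+k}+\epsilon^4\Delta^{(6)}+\epsilon^6\Delta^{(8)},$$ $$g_k=\frac{(2H_4^2-H_3H_1+\omega_kH_3^2)+\epsilon^2g_k^{(6)}+\epsilon^4g_k^{(8)}+\epsilon^6g_k^{(10)}}{2(p_1^2+p_2^2+p_3^2)\,\Delta}\quad(k=1,2,3),$$ $$g_4=\frac{g_2-g_3}{\omega_2-\omega_3},\qquad g_5=\frac{g_3-g_1}{\omega_3-\omega_1},\qquad g_6=\frac{g_1-g_2}{\omega_1-\omega_2}.$$ 1. $\Delta$ is the common denominator of the null-vector of $\Psi=(p_1^2,p_2^2,p_3^2,m_1p_1,m_2p_2,m_3p_3)$: for every $\epsilon\ne0$ and every $(m,p)$ with $\Delta\ne0$ the vector $(-1,-1,-1,d_7,d_8,d_9)$, with $d_k=(p_1^2+p_2^2+p_3^2)(1+\epsilon^2d_k^{(2)}+\epsilon^4d_k^{(4)}+\epsilon^6d_k^{(6)})/\Delta$, lies in $K_\Psi(m,p)$. 2. For every $\epsilon\neq0$,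 $\Theta=(p_1^2,p_2^2,p_3^2,m_1^2,m_2^2,m_3^2,m_1p_1+m_2p_2+m_3p_3)$ is an HK-basis for $f(\cdot,\epsilon)$; the functions $g_1,\dots,g_6$, defined where $(p_1^2+p_2^2+p_3^2)\Delta\ne0$, are integrals; and $(g_1,\dots,g_6,-1)\in K_\Theta(m,p)$ at every point $(m,p)$ with $(p_1^2+p_2^2+p_3^2)\Delta\neq0$. 3. For every $\epsilon\ne0$ there is a nonzero polynomial $Q$ in $(m,p)$ such that at every point with $Q(m,p)\ne0$ the functions $g_1,\dots,g_6$ are defined, $\dim K_\Theta(m,p)=1$ and $K_\Theta(m,p)=[g_1:g_2:g_3:g_4:g_5:g_6:-1]$. -/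

import Mathlib

open Matrix

namespace Clebsch

/-! ### Partial maps, their iterates, and Hirota–Kimura bases -/

/-- The `n`-fold iterate of a partial map, defined as long as all the steps are. -/
def iter {X : Type*} (f : X →. X) : ℕ → X →. X
  | 0 => PFun.id X
  | n + 1 => f.comp (iter f n)

/-- The iterate `f ^ i`, `i ∈ ℤ`, of a partial map `f` with (partial) inverse `finv`. -/
def zIter {X : Type*} (f finv : X →. X) : ℤ → X →. X
  | Int.ofNat n => iter f n
  | Int.negSucc n => iter finv (n + 1)

/-- The null-space `K_Φ(x)`: all `c` such that `c₁ φ₁ + ⋯ + c_l φ_l` vanishes at every point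
`f ^ i (x)`, `i ∈ ℤ`, of the orbit of `x` (at every one that is defined). -/
def nullSpace {X : Type*} (f finv : X →. X) {l : ℕ} (φ : Fin l → X → ℝ) (x : X) :
    Submodule ℝ (Fin l → ℝ) where
  carrier := {c | ∀ i : ℤ, ∀ y ∈ zIter f finv i x, ∑ j, c j * φ j y = 0}
  zero_mem' := by
    intro i y _
    simp
  add_mem' := by
    intro a b ha hb i y hy
    simp only [Pi.add_apply, add_mul, Finset.sum_add_distrib, ha i y hy, hb i y hy, add_zero]
  smul_mem' := by
    intro r a ha i y hy
    simp only [Pi.smul_apply, smul_eq_mul, mul_assoc, ← Finset.mul_sum, ha i y hy, mul_zero]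

/-- `Φ = (φ₁, …, φ_l)` is a Hirota–Kimura basis for `f`. -/
def IsHKBasis {X : Type*} (f finv : X →. X) {l : ℕ} (φ : Fin l → X → ℝ) : Prop :=
  LinearIndependent ℝ φ ∧ ∀ x : X, ∃ c ∈ nullSpace f finv φ x, c ≠ 0

/-- The function `h`, defined on `U`, is an integral (conserved quantity) of `f`. -/
def IsIntegralOf {X : Type*} (f : X →. X) (U : Set X) (h : X → ℝ) : Prop :=
  ∀ x ∈ U, ∀ y ∈ f x, y ∈ U → h y = h x

/-! ### The discrete Clebsch system -/

/-- The phase space `ℝ⁶`, with coordinates `(m₁, m₂, m₃, p₁, p₂, p₃)`. -/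
abbrev Phase := Fin 6 → ℝ

/-- The matrix `M(m, p, ε)` of the Kahan–Hirota–Kimura discretization
`m̃₁ - m₁ = ε (ω₃ - ω₂) (p̃₂ p₃ + p₂ p̃₃)`,
`p̃₁ - p₁ = ε (m̃₃ p₂ + m₃ p̃₂) - ε (m̃₂ p₃ + m₂ p̃₃)` (and cyclically) of the Clebsch system:
these equations read `M(m, p, ε) (m̃, p̃) = (m, p)`. -/
def kahanMatrix (ω : Fin 3 → ℝ) (ε : ℝ) (x : Phase) : Matrix (Fin 6) (Fin 6) ℝ :=
  let m₁ := x 0; let m₂ := x 1; let m₃ := x 2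
  let p₁ := x 3; let p₂ := x 4; let p₃ := x 5
  let ω₂₃ := ω 1 - ω 2; let ω₃₁ := ω 2 - ω 0; let ω₁₂ := ω 0 - ω 1
  !![1, 0, 0, 0, ε * ω₂₃ * p₃, ε * ω₂₃ * p₂;
     0, 1, 0, ε * ω₃₁ * p₃, 0, ε * ω₃₁ * p₁;
     0, 0, 1, ε * ω₁₂ * p₂, ε * ω₁₂ * p₁, 0;
     0, ε * p₃, -ε * p₂, 1, -ε * m₃, ε * m₂;
     -ε * p₃, 0, ε * p₁, ε * m₃, 1, -ε * m₁;
     ε * p₂, -ε * p₁, 0, -ε * m₂, ε * m₁, 1]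

/-- The discrete Clebsch map `f(m, p, ε) = M(m, p, ε)⁻¹ (m, p)`, a rational map of `ℝ⁶`, defined
where `det M(m, p, ε) ≠ 0`. -/
noncomputable def clebschMap (ω : Fin 3 → ℝ) (ε : ℝ) : Phase →. Phase :=
  fun x => ⟨(kahanMatrix ω ε x).det ≠ 0, fun _ => (kahanMatrix ω ε x)⁻¹ *ᵥ x⟩

theorem kahanMatrix_mulVec_comm (ω : Fin 3 → ℝ) (ε : ℝ) (x y : Phase) :
    kahanMatrix ω ε x *ᵥ y = x ↔ kahanMatrix ω (-ε) y *ᵥ x = y := by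
  have h : kahanMatrix ω ε x *ᵥ y - x = -(kahanMatrix ω (-ε) y *ᵥ x - y) := by
    ext i
    fin_cases i <;>
      simp [kahanMatrix, dotProduct, Fin.sum_univ_succ, Matrix.vecHead, Matrix.vecTail] <;> ring
  rw [← sub_eq_zero, h, neg_eq_zero, sub_eq_zero]

/-- `y = f(x, ε)` if and only if `y` is the only solution of the implicit equations. -/
theorem mem_clebschMap (ω : Fin 3 → ℝ) (ε : ℝ) (x y : Phase) :
    y ∈ clebschMap ω ε x ↔ (kahanMatrix ω ε x).det ≠ 0 ∧ kahanMatrix ω ε x *ᵥ y = x := by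
  constructor
  · rintro ⟨h, rfl⟩
    have h' : (kahanMatrix ω ε x).det ≠ 0 := h
    refine ⟨h', ?_⟩
    change kahanMatrix ω ε x *ᵥ ((kahanMatrix ω ε x)⁻¹ *ᵥ x) = x
    rw [Matrix.mulVec_mulVec, Matrix.mul_nonsing_inv _ h'.isUnit, Matrix.one_mulVec]
  · rintro ⟨h, hy⟩
    refine ⟨h, ?_⟩
    change (kahanMatrix ω ε x)⁻¹ *ᵥ x = y
    have h' := congrArg (fun v => (kahanMatrix ω ε x)⁻¹ *ᵥ v) hy
    simp only [Matrix.mulVec_mulVec, Matrix.nonsing_inv_mul _ h.isUnit, Matrix.one_mulVec] at h'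
    exact h'.symm

/-- Reversibility: the rational map `f(·, -ε)` is inverse to `f(·, ε)`. -/
theorem clebschMap_reverse (ω : Fin 3 → ℝ) (ε : ℝ) (x y : Phase) (h : y ∈ clebschMap ω ε x)
    (hy : (clebschMap ω (-ε) y).Dom) : x ∈ clebschMap ω (-ε) y :=
  (mem_clebschMap ω (-ε) y x).2
    ⟨hy, (kahanMatrix_mulVec_comm ω ε x y).1 ((mem_clebschMap ω ε x y).1 h).2⟩

/-- The null-space `K_Φ(m, p)` for the discrete Clebsch system; its inverse is `f(·, -ε)`. -/
noncomputable def clebschNullSpace (ω : Fin 3 → ℝ) (ε : ℝ) {l : ℕ} (φ : Fin l → Phase → ℝ)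
    (x : Phase) : Submodule ℝ (Fin l → ℝ) :=
  nullSpace (clebschMap ω ε) (clebschMap ω (-ε)) φ x

/-- `Θ = (p₁², p₂², p₃², m₁², m₂², m₃², m₁p₁ + m₂p₂ + m₃p₃)`. -/
def Theta : Fin 7 → Phase → ℝ :=
  ![fun x => x 3 ^ 2, fun x => x 4 ^ 2, fun x => x 5 ^ 2,
    fun x => x 0 ^ 2, fun x => x 1 ^ 2, fun x => x 2 ^ 2,
    fun x => x 0 * x 3 + x 1 * x 4 + x 2 * x 5]

/-- `Ψ = (p₁², p₂², p₃², m₁p₁, m₂p₂, m₃p₃)`. -/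
def Psi : Fin 6 → Phase → ℝ :=
  ![fun x => x 3 ^ 2, fun x => x 4 ^ 2, fun x => x 5 ^ 2,
    fun x => x 0 * x 3, fun x => x 1 * x 4, fun x => x 2 * x 5]

/-! ### Polynomials in the phase variables -/

/-- Polynomials in `m₁, m₂, m₃, p₁, p₂, p₃` (the variables `0, …, 5`). -/
abbrev PhasePoly := MvPolynomial (Fin 6) ℝ

/-- The variable `m_k`. -/
noncomputable def mVar (k : Fin 3) : PhasePoly := MvPolynomial.X (Fin.castAdd 3 k)

/-- The variable `p_k`. -/
noncomputable def pVar (k : Fin 3) : PhasePoly := MvPolynomial.X (Fin.natAdd 3 k)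

/-- `H₁ = m₁² + m₂² + m₃² + ω₁p₁² + ω₂p₂² + ω₃p₃²`. -/
noncomputable def H₁ (ω : Fin 3 → ℝ) : PhasePoly :=
  ∑ k, (mVar k ^ 2 + MvPolynomial.C (ω k) * pVar k ^ 2)

/-- `H₃ = p₁² + p₂² + p₃²`. -/
noncomputable def H₃ : PhasePoly := ∑ k, pVar k ^ 2

/-- `H₄ = m₁p₁ + m₂p₂ + m₃p₃`. -/
noncomputable def H₄ : PhasePoly := ∑ k, mVar k * pVar k

/-- The quadratic polynomials `d₇⁽²⁾, d₈⁽²⁾, d₉⁽²⁾` (for `k = 0, 1, 2`); with `(k, i, j)` cyclic,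
`m₁² + m₂² + m₃² + (ω_i + ω_j - 2ω_k) p_k² + (ω_j - ω_i) p_i² + (ω_i - ω_j) p_j²`. -/
noncomputable def d2 (ω : Fin 3 → ℝ) (k : Fin 3) : PhasePoly :=
  ∑ i, mVar i ^ 2
    + MvPolynomial.C (ω (k + 1) + ω (k + 2) - 2 * ω k) * pVar k ^ 2
    + MvPolynomial.C (ω (k + 2) - ω (k + 1)) * pVar (k + 1) ^ 2
    + MvPolynomial.C (ω (k + 1) - ω (k + 2)) * pVar (k + 2) ^ 2

/-- The value at `x` of the even polynomial `P₀ + ε² P₁ + ε⁴ P₂ + ε⁶ P₃` in `ε`. -/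
noncomputable def evenSum (ε : ℝ) (P : Fin 4 → PhasePoly) (x : Phase) : ℝ :=
  ∑ q : Fin 4, ε ^ (2 * (q : ℕ)) * MvPolynomial.eval x (P q)

/-- `d_{7+k} = (p₁² + p₂² + p₃²) (d₀ + ε² d₁ + ε⁴ d₂ + ε⁶ d₃) / Δ`. -/
noncomputable def dFun (ε : ℝ) (Δ : Fin 4 → PhasePoly) (d : Fin 3 → Fin 4 → PhasePoly)
    (k : Fin 3) (x : Phase) : ℝ :=
  MvPolynomial.eval x H₃ * evenSum ε (d k) x / evenSum ε Δ x

/-- `(g₁, …, g₆)`: the first three entries are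
`(G₀ + ε² G₁ + ε⁴ G₂ + ε⁶ G₃) / (2 (p₁² + p₂² + p₃²) Δ)`, the others are divided differences. -/
noncomputable def gFun (ω : Fin 3 → ℝ) (ε : ℝ) (Δ : Fin 4 → PhasePoly)
    (G : Fin 3 → Fin 4 → PhasePoly) (x : Phase) : Fin 6 → ℝ :=
  let g : Fin 3 → ℝ := fun k =>
    evenSum ε (G k) x / (2 * MvPolynomial.eval x H₃ * evenSum ε Δ x)
  ![g 0, g 1, g 2,
    (g 1 - g 2) / (ω 1 - ω 2), (g 2 - g 0) / (ω 2 - ω 0), (g 0 - g 1) / (ω 0 - ω 1)]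

/-- The domain of `g₁, …, g₆`. -/
def gDom (ε : ℝ) (Δ : Fin 4 → PhasePoly) : Set Phase :=
  {x | MvPolynomial.eval x H₃ ≠ 0 ∧ evenSum ε Δ x ≠ 0}

end Clebsch

open Clebsch

/-! Write x = (m, p) and y = (m̃, p̃) for a step, and Ω = diag ω. Substituting the equations for m̃
into those for p̃ leaves a 3 × 3 system (diag C + [u]×) p̃ = p + ε p × m with determinant D.
Cramer's rule gives D (p · p̃) = R and D (1 + ε² p · Ωp̃) = S with R, S even in ε. The scalars a = p
· p̃ and b = 1 + ε² p · Ωp̃ are symmetric in x and y, and the backward step is the forward one for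
-ε. So R and S at y are the same a and b times another determinant, which cancels in the quotients.
With n_k = b - ε² a ω_k and u = ∑ n_k m_k p_k one gets Δ = D u, d_k = p² n_k / u and g_k = m · p /
p² - a (E - p² G_k) / (2 p² u), where E = m · Cm + p · Gp. Conservation of d_k amounts to that of p²
/ u (`Step.normSq_mul_nDot`). For g_k one also needs that G_k / p² is conserved and that the changes
of m · p / p² and of E / p² match (`Step.mpDot_mul`, `Step.energy_diff`). Differences of the g_k are
multiples of the C_k, so the relation for Θ is the definition of E.

These identities need nonvanishing conditions. They extend to all orbits by density: iterates are
quotients of polynomials, and the polynomial excluding the bad orbit segments is nonzero because it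
does not vanish at a generic fixed point (`exists_poly_invariant`, `exists_generic_fixedPoint`).
Continuity then gives the relations wherever the coefficients are defined. At the remaining points a
null-vector of Θ is a limit of normalized ones, by compactness of the sphere.

For dimension one, any null-vector can be reduced by (g, -1) to a relation among the six squares, so
one orbit segment with independent squares suffices: a Gram determinant is then a nonzero
polynomial. Symmetry and scaling reduce to ε = 1 and ω = (0, -1/4, -t²), 0 < t < 1/2. Rescaling by
(δ², δ, δ, 1, δ, δ) and letting δ → 0 gives a map with an explicit orbit built from 3^i, 3^(-i) and
μ^i. The squares themselves degenerate there, but suitable combinations of them have limits whose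
increments are combinations of seven distinct exponentials, and a Vandermonde argument proves these
limits independent (`eq_zero_of_adaptedFun_limitOrbit`). Independence is an open condition, so it
holds for small δ ≠ 0. -/

namespace Clebsch

/-! ### Quadratic invariants and the even polynomials `R`, `S` -/

/-- The bilinear form `p · W p'` of the `p`-components, where `W = diag w`. -/
def pDot (w : Fin 3 → ℝ) (x y : Phase) : ℝ := w 0 * x 3 * y 3 + w 1 * x 4 * y 4 + w 2 * x 5 * y 5
/-- The bilinear form `m · W p'`. -/
def mpDot (w : Fin 3 → ℝ) (x y : Phase) : ℝ := w 0 * x 0 * y 3 + w 1 * x 1 * y 4 + w 2 * x 2 * y 5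
/-- The bilinear form `m · W m'`. -/
def mDot (w : Fin 3 → ℝ) (x y : Phase) : ℝ := w 0 * x 0 * y 0 + w 1 * x 1 * y 1 + w 2 * x 2 * y 2

def e₁ (ω : Fin 3 → ℝ) : ℝ := ω 0 + ω 1 + ω 2
def e₂ (ω : Fin 3 → ℝ) : ℝ := ω 0 * ω 1 + ω 1 * ω 2 + ω 2 * ω 0
def e₃ (ω : Fin 3 → ℝ) : ℝ := ω 0 * ω 1 * ω 2

/-- The Cramer numerator of p · p̃, expanded. Odd powers of ε cancel, so the same value serves the
backward step. -/
def RVal (ω : Fin 3 → ℝ) (ε : ℝ) (x : Phase) : ℝ :=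
  let p₀ := pDot 1 x x; let p₁ := pDot ω x x; let p₂ := pDot (ω ^ 2) x x
  let q₀ := mpDot 1 x x; let q₁ := mpDot ω x x; let s₀ := mDot 1 x x; let s₁ := mDot ω x x
  p₀ + ε ^ 2 * (2 * q₀ ^ 2 - p₀ * s₀ - 3 * p₀ * p₁ + e₁ ω * p₀ ^ 2)
    + ε ^ 4 * (-2 * p₁ * q₀ ^ 2 + 2 * p₀ * q₀ * q₁ + p₀ * p₁ * s₀ + 2 * p₀ * p₁ ^ 2
      - p₀ ^ 2 * s₁ + p₀ ^ 2 * p₂ - 2 * e₁ ω * p₀ ^ 2 * p₁ + e₂ ω * p₀ ^ 3)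

/-- The Cramer numerator of 1 + ε² p · Ωp̃; again only even powers of ε survive. -/
def SVal (ω : Fin 3 → ℝ) (ε : ℝ) (x : Phase) : ℝ :=
  let p₀ := pDot 1 x x; let p₁ := pDot ω x x; let p₂ := pDot (ω ^ 2) x x
  let q₀ := mpDot 1 x x; let q₁ := mpDot ω x x; let s₀ := mDot 1 x x; let s₁ := mDot ω x x
  1 + ε ^ 2 * (s₀ - 2 * p₁ + e₁ ω * p₀)
    + ε ^ 4 * (2 * q₀ * q₁ - 2 * p₁ * s₀ + p₁ ^ 2 + p₀ * s₁ - p₀ * p₂ - e₁ ω * p₀ * p₁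
      + e₂ ω * p₀ ^ 2)
    + ε ^ 6 * (-2 * p₁ * q₀ * q₁ + p₁ ^ 2 * s₀ + 2 * p₀ * q₁ ^ 2 - p₀ * p₁ * s₁ + p₀ * p₁ * p₂
      - e₂ ω * p₀ ^ 2 * p₁ + 2 * e₃ ω * p₀ ^ 3)

/-- The diagonal matrix `C = 1 - ε² (p · Ω p) + ε² (p · p) Ω`. -/
def cDiag (ω : Fin 3 → ℝ) (ε : ℝ) (x : Phase) (k : Fin 3) : ℝ :=
  1 - ε ^ 2 * pDot ω x x + ε ^ 2 * pDot 1 x x * ω k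

/-- The vector `ε m + ε² p × Ω p`. -/
def axialVec (ω : Fin 3 → ℝ) (ε : ℝ) (x : Phase) : Fin 3 → ℝ :=
  ![ε * x 0 + ε ^ 2 * (ω 2 - ω 1) * x 4 * x 5, ε * x 1 + ε ^ 2 * (ω 0 - ω 2) * x 5 * x 3,
    ε * x 2 + ε ^ 2 * (ω 1 - ω 0) * x 3 * x 4]

/-- The determinant of the `3 × 3` system for `p̃`. -/
def redDet (ω : Fin 3 → ℝ) (ε : ℝ) (x : Phase) : ℝ :=
  let c := cDiag ω ε x; let u := axialVec ω ε x
  c 0 * c 1 * c 2 + c 0 * u 0 ^ 2 + c 1 * u 1 ^ 2 + c 2 * u 2 ^ 2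

/-- The adjugate of `diag c + [u]×` -/
def adjApply (c u v : Fin 3 → ℝ) : Fin 3 → ℝ :=
  ![c 1 * c 2 * v 0 + u 0 * (u 0 * v 0 + u 1 * v 1 + u 2 * v 2)
      + (c 1 * u 1 * v 2 - c 2 * u 2 * v 1),
    c 2 * c 0 * v 1 + u 1 * (u 0 * v 0 + u 1 * v 1 + u 2 * v 2)
      + (c 2 * u 2 * v 0 - c 0 * u 0 * v 2),
    c 0 * c 1 * v 2 + u 2 * (u 0 * v 0 + u 1 * v 1 + u 2 * v 2)
      + (c 0 * u 0 * v 1 - c 1 * u 1 * v 0)]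

/-- The implicit equations of the discrete Clebsch system. -/
structure Step (ω : Fin 3 → ℝ) (ε : ℝ) (x y : Phase) : Prop where
  m₁ : y 0 - x 0 - ε * (ω 2 - ω 1) * (x 4 * y 5 + x 5 * y 4) = 0
  m₂ : y 1 - x 1 - ε * (ω 0 - ω 2) * (x 5 * y 3 + x 3 * y 5) = 0
  m₃ : y 2 - x 2 - ε * (ω 1 - ω 0) * (x 3 * y 4 + x 4 * y 3) = 0
  p₁ : y 3 - x 3 - ε * (x 4 * y 2 - x 5 * y 1 + y 4 * x 2 - y 5 * x 1) = 0
  p₂ : y 4 - x 4 - ε * (x 5 * y 0 - x 3 * y 2 + y 5 * x 0 - y 3 * x 2) = 0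
  p₃ : y 5 - x 5 - ε * (x 3 * y 1 - x 4 * y 0 + y 3 * x 1 - y 4 * x 0) = 0

theorem step_iff (ω : Fin 3 → ℝ) (ε : ℝ) (x y : Phase) :
    Step ω ε x y ↔ kahanMatrix ω ε x *ᵥ y = x := by
  constructor
  · rintro ⟨h1, h2, h3, h4, h5, h6⟩
    ext i
    fin_cases i <;>
      simp [kahanMatrix, dotProduct, Fin.sum_univ_succ]
    · linear_combination h1
    · linear_combination h2
    · linear_combination h3
    · linear_combination h4
    · linear_combination h5
    · linear_combination h6
  · intro h
    have h0 := congrFun h 0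
    have h1 := congrFun h 1
    have h2 := congrFun h 2
    have h3 := congrFun h 3
    have h4 := congrFun h 4
    have h5 := congrFun h 5
    simp [kahanMatrix, dotProduct, Fin.sum_univ_succ]
      at h0 h1 h2 h3 h4 h5
    constructor
    · linear_combination h0
    · linear_combination h1
    · linear_combination h2
    · linear_combination h3
    · linear_combination h4
    · linear_combination h5

theorem Step.reverse {ω : Fin 3 → ℝ} {ε : ℝ} {x y : Phase} (h : Step ω ε x y) :
    Step ω (-ε) y x := by
  rw [step_iff] at h ⊢
  exact (kahanMatrix_mulVec_comm ω ε x y).1 h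

/-! ### One step of the map: bilinear identities -/

section OneStep

variable {ω : Fin 3 → ℝ} {ε : ℝ} {x y : Phase}

/-- `p̃² (1 - ε² p · Ω p) = p² (1 - ε² p̃ · Ω p̃)`. -/
theorem Step.normSq_mul (h : Step ω ε x y) :
    pDot 1 y y * (1 - ε ^ 2 * pDot ω x x) = pDot 1 x x * (1 - ε ^ 2 * pDot ω y y) := by
  obtain ⟨h1, h2, h3, h4, h5, h6⟩ := h
  simp only [pDot, Pi.one_apply]
  -- Pairing the p-equations with p + p̃ leaves the triple product (m̃ - m) · (p × p̃), which the
  -- m-equations evaluate.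
  linear_combination (x 3 + y 3) * h4 + (x 4 + y 4) * h5 + (x 5 + y 5) * h6
    - ε * ((x 4 * y 5 - x 5 * y 4) * h1 + (x 5 * y 3 - x 3 * y 5) * h2
      + (x 3 * y 4 - x 4 * y 3) * h3)

/-- `C_k(y) p² = C_k(x) p̃²`. -/
theorem Step.cDiag_mul (h : Step ω ε x y) (k : Fin 3) :
    cDiag ω ε y k * pDot 1 x x = cDiag ω ε x k * pDot 1 y y := by
  have := h.normSq_mul
  simp only [cDiag]
  linear_combination -this

/-- The reduced linear equation `(diag C + [u]×) p̃ = p + ε p × m`, with `u` the axial vector. -/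
theorem Step.reduced (h : Step ω ε x y) :
    (cDiag ω ε x 0 * y 3 + (axialVec ω ε x 1 * y 5 - axialVec ω ε x 2 * y 4)
        = x 3 + ε * (x 4 * x 2 - x 5 * x 1)) ∧
    (cDiag ω ε x 1 * y 4 + (axialVec ω ε x 2 * y 3 - axialVec ω ε x 0 * y 5)
        = x 4 + ε * (x 5 * x 0 - x 3 * x 2)) ∧
    (cDiag ω ε x 2 * y 5 + (axialVec ω ε x 0 * y 4 - axialVec ω ε x 1 * y 3)
        = x 5 + ε * (x 3 * x 1 - x 4 * x 0)) := by
  obtain ⟨h1, h2, h3, h4, h5, h6⟩ := h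
  simp only [pDot, cDiag, axialVec, Pi.one_apply, Matrix.cons_val_zero, Matrix.cons_val_one,
    Matrix.cons_val]
  refine ⟨?_, ?_, ?_⟩
  · linear_combination h4 + ε * (x 4 * h3 - x 5 * h2)
  · linear_combination h5 + ε * (x 5 * h1 - x 3 * h3)
  · linear_combination h6 + ε * (x 3 * h2 - x 4 * h1)

/-- `v · adj(A) r = det(A) (v · w)` for `A w = r`, where `A = diag c + [u]×`. -/
theorem adjApply_dot (c u v w r : Fin 3 → ℝ)
    (h0 : c 0 * w 0 + (u 1 * w 2 - u 2 * w 1) = r 0)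
    (h1 : c 1 * w 1 + (u 2 * w 0 - u 0 * w 2) = r 1)
    (h2 : c 2 * w 2 + (u 0 * w 1 - u 1 * w 0) = r 2) :
    (c 0 * c 1 * c 2 + c 0 * u 0 ^ 2 + c 1 * u 1 ^ 2 + c 2 * u 2 ^ 2) *
        (v 0 * w 0 + v 1 * w 1 + v 2 * w 2)
      = adjApply c u v 0 * r 0 + adjApply c u v 1 * r 1 + adjApply c u v 2 * r 2 := by
  rw [← h0, ← h1, ← h2]
  simp only [adjApply, Matrix.cons_val_zero, Matrix.cons_val_one, Matrix.cons_val]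
  ring

theorem RVal_eq (ω : Fin 3 → ℝ) (ε : ℝ) (x : Phase) :
    RVal ω ε x
      = adjApply (cDiag ω ε x) (axialVec ω ε x) ![x 3, x 4, x 5] 0
          * (x 3 + ε * (x 4 * x 2 - x 5 * x 1))
        + adjApply (cDiag ω ε x) (axialVec ω ε x) ![x 3, x 4, x 5] 1
          * (x 4 + ε * (x 5 * x 0 - x 3 * x 2))
        + adjApply (cDiag ω ε x) (axialVec ω ε x) ![x 3, x 4, x 5] 2
          * (x 5 + ε * (x 3 * x 1 - x 4 * x 0)) := by
  simp only [pDot, mpDot, mDot, e₁, e₂, RVal, cDiag, axialVec, adjApply, Pi.one_apply,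
    Pi.pow_apply, Matrix.cons_val_zero, Matrix.cons_val_one, Matrix.cons_val]
  ring

theorem SVal_eq (ω : Fin 3 → ℝ) (ε : ℝ) (x : Phase) :
    SVal ω ε x
      = redDet ω ε x + ε ^ 2 * (
        adjApply (cDiag ω ε x) (axialVec ω ε x) ![ω 0 * x 3, ω 1 * x 4, ω 2 * x 5] 0
          * (x 3 + ε * (x 4 * x 2 - x 5 * x 1))
        + adjApply (cDiag ω ε x) (axialVec ω ε x) ![ω 0 * x 3, ω 1 * x 4, ω 2 * x 5] 1
          * (x 4 + ε * (x 5 * x 0 - x 3 * x 2))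
        + adjApply (cDiag ω ε x) (axialVec ω ε x) ![ω 0 * x 3, ω 1 * x 4, ω 2 * x 5] 2
          * (x 5 + ε * (x 3 * x 1 - x 4 * x 0))) := by
  simp only [pDot, mpDot, mDot, e₁, e₂, e₃, SVal, redDet, cDiag, axialVec, adjApply, Pi.one_apply,
    Pi.pow_apply, Matrix.cons_val_zero, Matrix.cons_val_one, Matrix.cons_val]
  ring

theorem Step.redDet_mul_pDot (h : Step ω ε x y) :
    redDet ω ε x * pDot 1 x y = RVal ω ε x := by
  obtain ⟨h1, h2, h3⟩ := h.reduced
  rw [RVal_eq]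
  have := adjApply_dot (cDiag ω ε x) (axialVec ω ε x) ![x 3, x 4, x 5] ![y 3, y 4, y 5]
    ![_, _, _] h1 h2 h3
  simpa [pDot, redDet] using this

theorem Step.redDet_mul_one_add (h : Step ω ε x y) :
    redDet ω ε x * (1 + ε ^ 2 * pDot ω x y) = SVal ω ε x := by
  obtain ⟨h1, h2, h3⟩ := h.reduced
  rw [SVal_eq]
  have := adjApply_dot (cDiag ω ε x) (axialVec ω ε x) ![ω 0 * x 3, ω 1 * x 4, ω 2 * x 5]
    ![y 3, y 4, y 5] ![_, _, _] h1 h2 h3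
  rw [mul_add, mul_one, mul_left_comm]
  congr 2

/-- The linear system for `p̃` with the bilinear coefficients `a = p · p̃`, `b = 1 + ε² p · Ω p̃`,
dotted with an arbitrary vector `v`. -/
theorem Step.linear (h : Step ω ε x y) :
    (cDiag ω ε x 0 * y 3 + ε * (x 1 * y 5 - x 2 * y 4) - (1 + ε ^ 2 * pDot ω x y
        - ε ^ 2 * pDot 1 x y * ω 0) * x 3 + ε * (x 1 * x 5 - x 2 * x 4) = 0) ∧
    (cDiag ω ε x 1 * y 4 + ε * (x 2 * y 3 - x 0 * y 5) - (1 + ε ^ 2 * pDot ω x y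
        - ε ^ 2 * pDot 1 x y * ω 1) * x 4 + ε * (x 2 * x 3 - x 0 * x 5) = 0) ∧
    (cDiag ω ε x 2 * y 5 + ε * (x 0 * y 4 - x 1 * y 3) - (1 + ε ^ 2 * pDot ω x y
        - ε ^ 2 * pDot 1 x y * ω 2) * x 5 + ε * (x 0 * x 4 - x 1 * x 3) = 0) := by
  obtain ⟨h1, h2, h3, h4, h5, h6⟩ := h
  simp only [pDot, cDiag, Pi.one_apply]
  refine ⟨?_, ?_, ?_⟩
  · linear_combination h4 + ε * (x 4 * h3 - x 5 * h2)
  · linear_combination h5 + ε * (x 5 * h1 - x 3 * h3)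
  · linear_combination h6 + ε * (x 3 * h2 - x 4 * h1)

/-- `n m · p` for `n_k = (1 + ε² p · Ω p̃) - ε² (p · p̃) ω_k`, where `p̃` belongs to `y` and
`m`, `p` to `z`. -/
def nDot (ω : Fin 3 → ℝ) (ε : ℝ) (x y z : Phase) : ℝ :=
  (1 + ε ^ 2 * pDot ω x y) * mpDot 1 z z - ε ^ 2 * pDot 1 x y * mpDot ω z z

/-- The linear system reads C p̃ + ε m × p̃ = n p - ε m × p. Pairing it with m kills both vector
products. -/
theorem Step.cDiag_dot_next (h : Step ω ε x y) :
    mpDot (cDiag ω ε x) x y = nDot ω ε x y x := by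
  obtain ⟨h1, h2, h3⟩ := h.linear
  simp only [nDot, mpDot, Pi.one_apply]
  linear_combination x 0 * h1 + x 1 * h2 + x 2 * h3

/-- Here m̃ is eliminated by the m-equations weighted with C p; what remains is removed by pairing
the linear system with -ε p × Ωp. -/
theorem Step.cDiag_next_dot (h : Step ω ε x y) :
    mpDot (cDiag ω ε x) y x = nDot ω ε x y x := by
  obtain ⟨l1, l2, l3⟩ := h.linear
  obtain ⟨h1, h2, h3, -, -, -⟩ := h
  linear_combination (norm := skip) (cDiag ω ε x 0 * x 3) * h1 + (cDiag ω ε x 1 * x 4) * h2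
    + (cDiag ω ε x 2 * x 5) * h3 + ε * ((ω 1 - ω 2) * x 4 * x 5 * l1
      + (ω 2 - ω 0) * x 5 * x 3 * l2 + (ω 0 - ω 1) * x 3 * x 4 * l3)
  simp only [nDot, mpDot, cDiag, pDot, Pi.one_apply]
  ring

theorem pDot_comm (w : Fin 3 → ℝ) (x y : Phase) : pDot w x y = pDot w y x := by
  simp only [pDot]; ring

theorem nDot_comm (ω : Fin 3 → ℝ) (ε : ℝ) (x y z : Phase) : nDot ω ε x y z = nDot ω ε y x z := by
  simp only [nDot, pDot_comm _ x y]

theorem nDot_neg (ω : Fin 3 → ℝ) (ε : ℝ) (x y z : Phase) :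
    nDot ω (-ε) x y z = nDot ω ε x y z := by
  simp only [nDot, neg_sq]

theorem cDiag_neg (ω : Fin 3 → ℝ) (ε : ℝ) (x : Phase) : cDiag ω (-ε) x = cDiag ω ε x := by
  ext k; simp only [cDiag, neg_sq]

/-- `p² (n m̃ · p̃) = p̃² (n m · p)`. -/
theorem Step.normSq_mul_nDot (h : Step ω ε x y) :
    pDot 1 x x * nDot ω ε x y y = pDot 1 y y * nDot ω ε x y x := by
  -- The backward step gives m̃ · C(y) p = ∑ n_k m̃_k p̃_k and the forward one m̃ · C(x) p = ∑ n_k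
  -- m_k p_k. The two left sides are proportional, as C / p² is conserved.
  have h1 := h.reverse.cDiag_dot_next
  rw [cDiag_neg, nDot_neg, nDot_comm] at h1
  rw [← h1, ← h.cDiag_next_dot]
  simp only [mpDot]
  linear_combination (y 0 * x 3) * h.cDiag_mul 0 + (y 1 * x 4) * h.cDiag_mul 1
    + (y 2 * x 5) * h.cDiag_mul 2

/-- `(m · p) p̃² - (m̃ · p̃) p² = (p · p̃) (m · p̃ - m̃ · p)`. -/
theorem Step.mpDot_mul (h : Step ω ε x y) (hε : ε ≠ 0) :
    mpDot 1 x x * pDot 1 y y - mpDot 1 y y * pDot 1 x x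
      = pDot 1 x y * (mpDot 1 x y - mpDot 1 y x) := by
  obtain ⟨-, -, -, h4, h5, h6⟩ := h
  apply mul_left_cancel₀ hε
  simp only [mpDot, pDot, Pi.one_apply]
  -- Since p × p̃ is orthogonal to p̃ - p, the p-equations paired with it give (p × p̃) · (p × m̃ +
  -- p̃ × m) = 0 after division by ε.
  linear_combination (x 4 * y 5 - x 5 * y 4) * h4 + (x 5 * y 3 - x 3 * y 5) * h5
    + (x 3 * y 4 - x 4 * y 3) * h6

/-- The adjugate of `diag ω`. -/
def coDiag (ω : Fin 3 → ℝ) : Fin 3 → ℝ := ![ω 1 * ω 2, ω 2 * ω 0, ω 0 * ω 1]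

/-- The vector product `m × p`, with `m` weighted by `w`. -/
def mCrossP (w : Fin 3 → ℝ) (x y : Phase) : Fin 3 → ℝ :=
  ![w 1 * x 1 * y 5 - w 2 * x 2 * y 4, w 2 * x 2 * y 3 - w 0 * x 0 * y 5,
    w 0 * x 0 * y 4 - w 1 * x 1 * y 3]

/-- The p-equations say p̃ - p = -ε (m × p̃ + m̃ × p). Pairing them with Ωm × p̃ - Ωm̃ × p produces
the left side, and the m-equations weighted by Ω(p × p̃) supply the rest. -/
theorem Step.weighted_cross (h : Step ω ε x y) (hε : ε ≠ 0) :
    (mCrossP 1 x y ⬝ᵥ mCrossP ω x y - mCrossP 1 y x ⬝ᵥ mCrossP ω y x)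
      = (mpDot ω x x * mpDot 1 y y - mpDot ω y y * mpDot 1 x x)
        + (pDot (coDiag ω) x x * pDot 1 y y - pDot (coDiag ω) y y * pDot 1 x x) := by
  obtain ⟨h1, h2, h3, h4, h5, h6⟩ := h
  apply mul_left_cancel₀ hε
  linear_combination (norm := skip)
    (mCrossP ω x y 0 - mCrossP ω y x 0) * h4 + (mCrossP ω x y 1 - mCrossP ω y x 1) * h5
    + (mCrossP ω x y 2 - mCrossP ω y x 2) * h6
    + ω 0 * (x 4 * y 5 - x 5 * y 4) * h1 + ω 1 * (x 5 * y 3 - x 3 * y 5) * h2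
    + ω 2 * (x 3 * y 4 - x 4 * y 3) * h3
  simp only [mCrossP, mpDot, pDot, coDiag, dotProduct, Fin.sum_univ_three, Pi.one_apply,
    Matrix.cons_val_zero, Matrix.cons_val_one, Matrix.cons_val]
  ring

/-- The diagonal matrix `G = (1 - ε² p · Ω p) Ω - ε² (p · p) adj Ω`. -/
def gDiag (ω : Fin 3 → ℝ) (ε : ℝ) (x : Phase) (k : Fin 3) : ℝ :=
  (1 - ε ^ 2 * pDot ω x x) * ω k - ε ^ 2 * pDot 1 x x * coDiag ω k

/-- The analogue of `Step.weighted_cross` with C in place of Ω. The right side is arranged so that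
inserting that identity cancels the adj Ω terms. -/
theorem Step.energy_cross (h : Step ω ε x y) (hε : ε ≠ 0) :
    2 * (mCrossP 1 x y ⬝ᵥ mCrossP (cDiag ω ε x) x y - mCrossP 1 y x ⬝ᵥ mCrossP (cDiag ω ε x) y x
      + (pDot (gDiag ω ε x) x x * pDot 1 y y - pDot (gDiag ω ε x) y y * pDot 1 x x))
      = ε ^ 2 * pDot 1 x x *
        ((mCrossP 1 x y ⬝ᵥ mCrossP ω x y - mCrossP 1 y x ⬝ᵥ mCrossP ω y x)
        + (mpDot ω x x * mpDot 1 y y - mpDot ω y y * mpDot 1 x x)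
        - (pDot (coDiag ω) x x * pDot 1 y y - pDot (coDiag ω) y y * pDot 1 x x)) := by
  obtain ⟨h1, h2, h3, h4, h5, h6⟩ := h
  apply mul_left_cancel₀ hε
  linear_combination (norm := skip)
    (mCrossP (cDiag ω ε x) x y 0 - mCrossP (cDiag ω ε x) y x 0
      + (1 - ε ^ 2 * pDot ω x x) * (mCrossP 1 x y 0 - mCrossP 1 y x 0)) * h4
    + (mCrossP (cDiag ω ε x) x y 1 - mCrossP (cDiag ω ε x) y x 1
      + (1 - ε ^ 2 * pDot ω x x) * (mCrossP 1 x y 1 - mCrossP 1 y x 1)) * h5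
    + (mCrossP (cDiag ω ε x) x y 2 - mCrossP (cDiag ω ε x) y x 2
      + (1 - ε ^ 2 * pDot ω x x) * (mCrossP 1 x y 2 - mCrossP 1 y x 2)) * h6
    + (cDiag ω ε x 0 + (1 - ε ^ 2 * pDot ω x x)) * (x 4 * y 5 - x 5 * y 4) * h1
    + (cDiag ω ε x 1 + (1 - ε ^ 2 * pDot ω x x)) * (x 5 * y 3 - x 3 * y 5) * h2
    + (cDiag ω ε x 2 + (1 - ε ^ 2 * pDot ω x x)) * (x 3 * y 4 - x 4 * y 3) * h3
  simp only [mCrossP, gDiag, cDiag, coDiag, dotProduct, Fin.sum_univ_three, Pi.one_apply,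
    Matrix.cons_val_zero, Matrix.cons_val_one, Matrix.cons_val, mpDot, pDot]
  ring

end OneStep

/-! ### Invariance of the coefficients under one generic step -/

/-- `m · C m + p · G p`. -/
def energyVal (ω : Fin 3 → ℝ) (ε : ℝ) (x y : Phase) : ℝ :=
  mDot (cDiag ω ε x) y y + pDot (gDiag ω ε x) y y

/-- This is ∑ m_k p_k (S - ε² ω_k R), which makes the relation for Ψ at the point itself an
identity. -/
def deltaVal (ω : Fin 3 → ℝ) (ε : ℝ) (x : Phase) : ℝ :=
  SVal ω ε x * mpDot 1 x x - ε ^ 2 * RVal ω ε x * mpDot ω x x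

noncomputable def dVal (ω : Fin 3 → ℝ) (ε : ℝ) (x : Phase) (k : Fin 3) : ℝ :=
  pDot 1 x x * (SVal ω ε x - ε ^ 2 * ω k * RVal ω ε x) / deltaVal ω ε x

noncomputable def gVal (ω : Fin 3 → ℝ) (ε : ℝ) (x : Phase) (k : Fin 3) : ℝ :=
  (2 * deltaVal ω ε x * mpDot 1 x x - RVal ω ε x * energyVal ω ε x x
    + pDot 1 x x * RVal ω ε x * gDiag ω ε x k) / (2 * pDot 1 x x * deltaVal ω ε x)

section

variable {ω : Fin 3 → ℝ} {ε : ℝ} {x y : Phase}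

theorem Step.gDiag_mul (h : Step ω ε x y) (k : Fin 3) :
    gDiag ω ε y k * pDot 1 x x = gDiag ω ε x k * pDot 1 y y := by
  have := h.normSq_mul
  simp only [gDiag]
  linear_combination -ω k * this

theorem Step.energyVal_mul (h : Step ω ε x y) :
    energyVal ω ε y y * pDot 1 x x = energyVal ω ε x y * pDot 1 y y := by
  have e1 : mDot (cDiag ω ε y) y y * pDot 1 x x = mDot (cDiag ω ε x) y y * pDot 1 y y := by
    simp only [mDot]
    linear_combination (y 0 * y 0) * h.cDiag_mul 0 + (y 1 * y 1) * h.cDiag_mul 1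
      + (y 2 * y 2) * h.cDiag_mul 2
  have e2 : pDot (gDiag ω ε y) y y * pDot 1 x x = pDot (gDiag ω ε x) y y * pDot 1 y y := by
    rw [pDot, pDot.eq_1 (gDiag ω ε x) y y]
    linear_combination (y 3 * y 3) * h.gDiag_mul 0 + (y 4 * y 4) * h.gDiag_mul 1
      + (y 5 * y 5) * h.gDiag_mul 2
  rw [energyVal, energyVal, add_mul, e1, e2, add_mul]

theorem lagrange_mCrossP (w : Fin 3 → ℝ) (x y : Phase) :
    mCrossP 1 x y ⬝ᵥ mCrossP w x y
      = mDot w x x * pDot 1 y y - mpDot 1 x y * mpDot w x y := by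
  simp only [mCrossP, mDot, mpDot, pDot, dotProduct, Fin.sum_univ_three, Pi.one_apply,
    Matrix.cons_val_zero, Matrix.cons_val_one, Matrix.cons_val]
  ring

/-- The factor 2 has two equal sources: Lagrange's identity applied to the vector products in
`Step.energy_cross`, and the Ω-weighted terms on its right side, evaluated in `h4`. -/
theorem Step.energy_diff (h : Step ω ε x y) (hε : ε ≠ 0) (ha : pDot 1 x y ≠ 0) :
    energyVal ω ε x x * pDot 1 y y - energyVal ω ε x y * pDot 1 x x
      = 2 * nDot ω ε x y x * (mpDot 1 x y - mpDot 1 y x) := by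
  have h1 := h.energy_cross hε
  rw [h.weighted_cross hε, lagrange_mCrossP, lagrange_mCrossP, h.cDiag_dot_next,
    h.cDiag_next_dot] at h1
  have h2 := h.normSq_mul_nDot
  have h3 := h.mpDot_mul hε
  -- Eliminating b between the values of ∑ n_k m_k p_k at x and at y leaves a multiple of a = p ·
  -- p̃, which is cancelled.
  have h4 : ε ^ 2 * pDot 1 x x * (mpDot ω x x * mpDot 1 y y - mpDot ω y y * mpDot 1 x x)
      = nDot ω ε x y x * (mpDot 1 x y - mpDot 1 y x) := by
    apply mul_left_cancel₀ ha
    have e : pDot 1 x x * (nDot ω ε x y x * mpDot 1 y y - nDot ω ε x y y * mpDot 1 x x)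
        = - (ε ^ 2 * pDot 1 x y * pDot 1 x x
          * (mpDot ω x x * mpDot 1 y y - mpDot ω y y * mpDot 1 x x)) := by
      simp only [nDot]; ring
    linear_combination mpDot 1 x x * h2 + e + nDot ω ε x y x * h3
  simp only [energyVal]
  linear_combination h1 / 2 + h4

/-- The nonvanishing conditions that make a point generic. -/
structure Generic (ω : Fin 3 → ℝ) (ε : ℝ) (x : Phase) : Prop where
  normSq : pDot 1 x x ≠ 0
  delta : deltaVal ω ε x ≠ 0
  num : RVal ω ε x ≠ 0
  det : redDet ω ε x ≠ 0
  det_neg : redDet ω (-ε) x ≠ 0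

/-! ### Evenness in ε and conservation along a step -/

theorem RVal_neg (ω : Fin 3 → ℝ) (ε : ℝ) (x : Phase) : RVal ω (-ε) x = RVal ω ε x := by
  simp only [RVal, Even.neg_pow (by decide : Even 2), Even.neg_pow (by decide : Even 4)]

theorem SVal_neg (ω : Fin 3 → ℝ) (ε : ℝ) (x : Phase) : SVal ω (-ε) x = SVal ω ε x := by
  simp only [SVal, Even.neg_pow (by decide : Even 2), Even.neg_pow (by decide : Even 4),
    Even.neg_pow (by decide : Even 6)]

theorem deltaVal_neg (ω : Fin 3 → ℝ) (ε : ℝ) (x : Phase) :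
    deltaVal ω (-ε) x = deltaVal ω ε x := by
  simp only [deltaVal, RVal_neg, SVal_neg, neg_sq]

theorem dVal_neg (ω : Fin 3 → ℝ) (ε : ℝ) : dVal ω (-ε) = dVal ω ε := by
  ext x k; simp only [dVal, RVal_neg, SVal_neg, deltaVal_neg, neg_sq]

theorem gDiag_neg (ω : Fin 3 → ℝ) (ε : ℝ) (x : Phase) : gDiag ω (-ε) x = gDiag ω ε x := by
  ext k; simp only [gDiag, neg_sq]

theorem gVal_neg (ω : Fin 3 → ℝ) (ε : ℝ) : gVal ω (-ε) = gVal ω ε := by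
  ext x k
  simp only [gVal, RVal_neg, deltaVal_neg, gDiag_neg, cDiag_neg, energyVal]

theorem Step.deltaVal_eq (h : Step ω ε x y) :
    deltaVal ω ε x = redDet ω ε x * nDot ω ε x y x := by
  rw [deltaVal, ← h.redDet_mul_pDot, ← h.redDet_mul_one_add, nDot]; ring

/-- The factor n_k is symmetric in the two points and the determinants cancel, so only the
conservation of p² / ∑ n_k m_k p_k is used. -/
theorem Step.dVal_eq (h : Step ω ε x y) (hx : Generic ω ε x) (hy : Generic ω ε y) :
    dVal ω ε y = dVal ω ε x := by
  ext k
  have hr := h.reverse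
  have e1 := h.deltaVal_eq
  have e2 := hr.deltaVal_eq
  rw [deltaVal_neg, nDot_neg, nDot_comm] at e2
  have r1 := h.redDet_mul_pDot
  have r2 := hr.redDet_mul_pDot
  have s1 := h.redDet_mul_one_add
  have s2 := hr.redDet_mul_one_add
  rw [RVal_neg, pDot_comm] at r2
  rw [SVal_neg, neg_sq, pDot_comm] at s2
  have hu : nDot ω ε x y x ≠ 0 := fun h0 => hx.delta (by rw [e1, h0, mul_zero])
  have hv : nDot ω ε x y y ≠ 0 := fun h0 => hy.delta (by rw [e2, h0, mul_zero])
  have hd := hx.det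
  have hd' := hy.det_neg
  simp only [dVal, e1, e2, ← r1, ← r2, ← s1, ← s2]
  rw [div_eq_div_iff (mul_ne_zero hd' hv) (mul_ne_zero hd hu)]
  linear_combination (-redDet ω ε x * redDet ω (-ε) y
    * ((1 + ε ^ 2 * pDot ω x y) - ε ^ 2 * ω k * pDot 1 x y)) * h.normSq_mul_nDot

theorem Step.gVal_eq (h : Step ω ε x y) (hε : ε ≠ 0) (hx : Generic ω ε x)
    (hy : Generic ω ε y) : gVal ω ε y = gVal ω ε x := by
  ext k
  have hr := h.reverse
  have e1 := h.deltaVal_eq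
  have e2 := hr.deltaVal_eq
  rw [deltaVal_neg, nDot_neg, nDot_comm] at e2
  have r1 := h.redDet_mul_pDot
  have r2 := hr.redDet_mul_pDot
  rw [RVal_neg, pDot_comm] at r2
  have hu : nDot ω ε x y x ≠ 0 := fun h0 => hx.delta (by rw [e1, h0, mul_zero])
  have hv : nDot ω ε x y y ≠ 0 := fun h0 => hy.delta (by rw [e2, h0, mul_zero])
  have hd := hx.det
  have hd' := hy.det_neg
  have ha : pDot 1 x y ≠ 0 := fun h0 => hx.num (by rw [← r1, h0, mul_zero])
  have hX := hx.normSq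
  have hY := hy.normSq
  have k1 := h.energy_diff hε ha
  have k2 := h.mpDot_mul hε
  have k3 := h.energyVal_mul
  have k4 := h.gDiag_mul k
  have k5 := h.normSq_mul_nDot
  simp only [gVal, e1, e2, ← r1, ← r2]
  generalize pDot 1 x x = A at *
  generalize pDot 1 y y = B at *
  generalize nDot ω ε x y x = u at *
  generalize nDot ω ε x y y = v at *
  generalize pDot 1 x y = a at *
  generalize redDet ω ε x = D at *
  generalize redDet ω (-ε) y = D' at *
  obtain rfl : v = B * u / A := by rw [eq_div_iff hX]; linear_combination k5
  have k4' : gDiag ω ε y k = gDiag ω ε x k * B / A := by rw [eq_div_iff hX, k4]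
  have k3' : energyVal ω ε y y = energyVal ω ε x y * B / A := by rw [eq_div_iff hX, k3]
  rw [k4', k3']
  -- Once G_k / p² and u / p² are known to be conserved, this is all that remains: m · p / p² and a
  -- E / (2 p² u) change by the same amount.
  have k6 : 2 * u * (mpDot 1 x x * B - mpDot 1 y y * A)
      = a * (energyVal ω ε x x * B - energyVal ω ε x y * A) := by rw [k1, k2]; ring
  field_simp
  linear_combination (-1 : ℝ) * k6

end

/-! ### The polynomials of the theorem -/

open MvPolynomial (C IsHomogeneous)

/-- `∑ w_k p_k²`. -/
noncomputable def pPoly (w : Fin 3 → ℝ) : PhasePoly := ∑ k, C (w k) * (pVar k * pVar k)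
/-- `∑ w_k m_k p_k`. -/
noncomputable def mpPoly (w : Fin 3 → ℝ) : PhasePoly := ∑ k, C (w k) * (mVar k * pVar k)
/-- `∑ w_k m_k²`. -/
noncomputable def mPoly (w : Fin 3 → ℝ) : PhasePoly := ∑ k, C (w k) * (mVar k * mVar k)

theorem isHomogeneous_pPoly (w : Fin 3 → ℝ) : (pPoly w).IsHomogeneous 2 :=
  IsHomogeneous.sum _ _ _ fun _ _ =>
    ((MvPolynomial.isHomogeneous_X _ _).mul (MvPolynomial.isHomogeneous_X _ _)).C_mul _

theorem isHomogeneous_mpPoly (w : Fin 3 → ℝ) : (mpPoly w).IsHomogeneous 2 :=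
  IsHomogeneous.sum _ _ _ fun _ _ =>
    ((MvPolynomial.isHomogeneous_X _ _).mul (MvPolynomial.isHomogeneous_X _ _)).C_mul _

theorem isHomogeneous_mPoly (w : Fin 3 → ℝ) : (mPoly w).IsHomogeneous 2 :=
  IsHomogeneous.sum _ _ _ fun _ _ =>
    ((MvPolynomial.isHomogeneous_X _ _).mul (MvPolynomial.isHomogeneous_X _ _)).C_mul _

theorem eval_pPoly (w : Fin 3 → ℝ) (x : Phase) : MvPolynomial.eval x (pPoly w) = pDot w x x := by
  simp [pPoly, pDot, Fin.sum_univ_three, pVar, mul_assoc]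

theorem eval_mpPoly (w : Fin 3 → ℝ) (x : Phase) :
    MvPolynomial.eval x (mpPoly w) = mpDot w x x := by
  simp [mpPoly, mpDot, Fin.sum_univ_three, pVar, mVar, mul_assoc]

theorem eval_mPoly (w : Fin 3 → ℝ) (x : Phase) : MvPolynomial.eval x (mPoly w) = mDot w x x := by
  simp [mPoly, mDot, Fin.sum_univ_three, mVar, mul_assoc]

/-- The coefficients of `R`. -/
noncomputable def RPoly (ω : Fin 3 → ℝ) : Fin 3 → PhasePoly :=
  let p₀ := pPoly 1; let p₁ := pPoly ω; let p₂ := pPoly (ω ^ 2)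
  let q₀ := mpPoly 1; let q₁ := mpPoly ω; let s₀ := mPoly 1; let s₁ := mPoly ω
  ![p₀,
    C 2 * (q₀ * q₀) - p₀ * s₀ - C 3 * (p₀ * p₁) + C (e₁ ω) * (p₀ * p₀),
    C (-2) * (p₁ * q₀ * q₀) + C 2 * (p₀ * q₀ * q₁) + p₀ * p₁ * s₀ + C 2 * (p₀ * p₁ * p₁)
      - p₀ * p₀ * s₁ + p₀ * p₀ * p₂ - C (2 * e₁ ω) * (p₀ * p₀ * p₁) + C (e₂ ω) * (p₀ * p₀ * p₀)]

/-- The coefficients of `S`. -/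
noncomputable def SPoly (ω : Fin 3 → ℝ) : Fin 4 → PhasePoly :=
  let p₀ := pPoly 1; let p₁ := pPoly ω; let p₂ := pPoly (ω ^ 2)
  let q₀ := mpPoly 1; let q₁ := mpPoly ω; let s₀ := mPoly 1; let s₁ := mPoly ω
  ![1, s₀ - C 2 * p₁ + C (e₁ ω) * p₀,
    C 2 * (q₀ * q₁) - C 2 * (p₁ * s₀) + p₁ * p₁ + p₀ * s₁ - p₀ * p₂ - C (e₁ ω) * (p₀ * p₁)
      + C (e₂ ω) * (p₀ * p₀),
    C (-2) * (p₁ * q₀ * q₁) + p₁ * p₁ * s₀ + C 2 * (p₀ * q₁ * q₁) - p₀ * p₁ * s₁ + p₀ * p₁ * p₂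
      - C (e₂ ω) * (p₀ * p₀ * p₁) + C (2 * e₃ ω) * (p₀ * p₀ * p₀)]

theorem isHomogeneous_RPoly (ω : Fin 3 → ℝ) (q : Fin 3) :
    (RPoly ω q).IsHomogeneous (2 + 2 * (q : ℕ)) := by
  have p₀ := isHomogeneous_pPoly 1
  have p₁ := isHomogeneous_pPoly ω
  have p₂ := isHomogeneous_pPoly (ω ^ 2)
  have q₀ := isHomogeneous_mpPoly 1
  have q₁ := isHomogeneous_mpPoly ω
  have s₀ := isHomogeneous_mPoly 1
  have s₁ := isHomogeneous_mPoly ω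
  fin_cases q
  · exact p₀
  · exact ((((q₀.mul q₀).C_mul _).sub (p₀.mul s₀)).sub ((p₀.mul p₁).C_mul _)).add
      ((p₀.mul p₀).C_mul _)
  · exact (((((((((p₁.mul q₀).mul q₀).C_mul _).add (((p₀.mul q₀).mul q₁).C_mul _)).add
      ((p₀.mul p₁).mul s₀)).add (((p₀.mul p₁).mul p₁).C_mul _)).sub ((p₀.mul p₀).mul s₁)).add
      ((p₀.mul p₀).mul p₂)).sub (((p₀.mul p₀).mul p₁).C_mul _)).add
      (((p₀.mul p₀).mul p₀).C_mul _)

theorem isHomogeneous_SPoly (ω : Fin 3 → ℝ) (q : Fin 4) :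
    (SPoly ω q).IsHomogeneous (2 * (q : ℕ)) := by
  have p₀ := isHomogeneous_pPoly 1
  have p₁ := isHomogeneous_pPoly ω
  have p₂ := isHomogeneous_pPoly (ω ^ 2)
  have q₀ := isHomogeneous_mpPoly 1
  have q₁ := isHomogeneous_mpPoly ω
  have s₀ := isHomogeneous_mPoly 1
  have s₁ := isHomogeneous_mPoly ω
  fin_cases q
  · exact MvPolynomial.isHomogeneous_one _ _
  · exact (s₀.sub (p₁.C_mul _)).add (p₀.C_mul _)
  · exact ((((((((q₀.mul q₁).C_mul _).sub ((p₁.mul s₀).C_mul _)).add (p₁.mul p₁)).add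
      (p₀.mul s₁)).sub (p₀.mul p₂)).sub ((p₀.mul p₁).C_mul _))).add ((p₀.mul p₀).C_mul _)
  · exact ((((((((p₁.mul q₀).mul q₁).C_mul _).add ((p₁.mul p₁).mul s₀)).add
      (((p₀.mul q₁).mul q₁).C_mul _)).sub ((p₀.mul p₁).mul s₁)).add ((p₀.mul p₁).mul p₂)).sub
      (((p₀.mul p₀).mul p₁).C_mul _)).add (((p₀.mul p₀).mul p₀).C_mul _)

attribute [irreducible] RPoly SPoly pPoly mPoly mpPoly

theorem vec4_apply {α : Type*} (a b c d : α) :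
    ![a, b, c, d] 0 = a ∧ ![a, b, c, d] 1 = b ∧ ![a, b, c, d] 2 = c ∧ ![a, b, c, d] 3 = d :=
  ⟨rfl, rfl, rfl, rfl⟩

/-- `d_k`, the numerators `S - ε² ω_k R`. -/
noncomputable def dPoly (ω : Fin 3 → ℝ) (k : Fin 3) : Fin 4 → PhasePoly :=
  ![SPoly ω 0, SPoly ω 1 - C (ω k) * RPoly ω 0, SPoly ω 2 - C (ω k) * RPoly ω 1,
    SPoly ω 3 - C (ω k) * RPoly ω 2]

theorem dPoly_apply (ω : Fin 3 → ℝ) (k : Fin 3) :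
    dPoly ω k 0 = SPoly ω 0 ∧ dPoly ω k 1 = SPoly ω 1 - C (ω k) * RPoly ω 0 ∧
    dPoly ω k 2 = SPoly ω 2 - C (ω k) * RPoly ω 1 ∧
    dPoly ω k 3 = SPoly ω 3 - C (ω k) * RPoly ω 2 := by
  rw [dPoly]
  exact vec4_apply _ _ _ _

noncomputable def deltaPoly (ω : Fin 3 → ℝ) (q : Fin 4) : PhasePoly :=
  ∑ k, mVar k * pVar k * dPoly ω k q

/-- The coefficients of `m · C m + p · G p`. -/
noncomputable def energyPoly (ω : Fin 3 → ℝ) : Fin 2 → PhasePoly :=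
  ![mPoly 1 + pPoly ω,
    pPoly 1 * mPoly ω - pPoly ω * mPoly 1 - pPoly ω * pPoly ω - pPoly 1 * pPoly (coDiag ω)]

/-- The coefficients of `G_k`. -/
noncomputable def gDiagPoly (ω : Fin 3 → ℝ) (k : Fin 3) : Fin 2 → PhasePoly :=
  ![C (ω k), -(C (ω k) * pPoly ω + C (coDiag ω k) * pPoly 1)]

/-- The coefficients of the numerators of `g_k`. -/
noncomputable def gPoly (ω : Fin 3 → ℝ) (k : Fin 3) : Fin 4 → PhasePoly :=
  let R := RPoly ω; let F := energyPoly ω; let D := gDiagPoly ω k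
  let Δ := fun q => C 2 * (deltaPoly ω q * mpPoly 1)
  ![Δ 0 - R 0 * F 0 + pPoly 1 * (R 0 * D 0),
    Δ 1 - (R 0 * F 1 + R 1 * F 0) + pPoly 1 * (R 0 * D 1 + R 1 * D 0),
    Δ 2 - (R 1 * F 1 + R 2 * F 0) + pPoly 1 * (R 1 * D 1 + R 2 * D 0),
    Δ 3 - R 2 * F 1 + pPoly 1 * (R 2 * D 1)]

theorem isHomogeneous_dPoly (ω : Fin 3 → ℝ) (k : Fin 3) (q : Fin 4) :
    (dPoly ω k q).IsHomogeneous (2 * (q : ℕ)) := by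
  obtain ⟨h0, h1, h2, h3⟩ := dPoly_apply ω k
  have R := isHomogeneous_RPoly ω
  have S := isHomogeneous_SPoly ω
  match q with
  | 0 => rw [h0]; exact S 0
  | 1 => rw [h1]; exact (S 1).sub ((R 0).C_mul _)
  | 2 => rw [h2]; exact (S 2).sub ((R 1).C_mul _)
  | 3 => rw [h3]; exact (S 3).sub ((R 2).C_mul _)

theorem isHomogeneous_deltaPoly (ω : Fin 3 → ℝ) (q : Fin 4) :
    (deltaPoly ω q).IsHomogeneous (2 + 2 * (q : ℕ)) :=
  IsHomogeneous.sum _ _ _ fun _ _ => ((MvPolynomial.isHomogeneous_X _ _).mul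
    (MvPolynomial.isHomogeneous_X _ _)).mul (isHomogeneous_dPoly _ _ _)

theorem isHomogeneous_energyPoly (ω : Fin 3 → ℝ) (q : Fin 2) :
    (energyPoly ω q).IsHomogeneous (2 + 2 * (q : ℕ)) := by
  have p := isHomogeneous_pPoly
  have s := isHomogeneous_mPoly
  fin_cases q
  · exact (s _).add (p _)
  · exact ((((p _).mul (s _)).sub ((p _).mul (s _))).sub ((p _).mul (p _))).sub ((p _).mul (p _))

theorem isHomogeneous_gDiagPoly (ω : Fin 3 → ℝ) (k : Fin 3) (q : Fin 2) :
    (gDiagPoly ω k q).IsHomogeneous (2 * (q : ℕ)) := by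
  have p := isHomogeneous_pPoly
  fin_cases q
  · exact MvPolynomial.isHomogeneous_C _ _
  · exact (((p _).C_mul _).add ((p _).C_mul _)).neg

theorem isHomogeneous_gPoly (ω : Fin 3 → ℝ) (k : Fin 3) (q : Fin 4) :
    (gPoly ω k q).IsHomogeneous (4 + 2 * (q : ℕ)) := by
  have R := isHomogeneous_RPoly ω
  have F := isHomogeneous_energyPoly ω
  have D := isHomogeneous_gDiagPoly ω k
  have p := isHomogeneous_pPoly 1
  have Δ := fun q => ((isHomogeneous_deltaPoly ω q).mul (isHomogeneous_mpPoly 1)).C_mul 2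
  fin_cases q
  · exact ((Δ 0).sub ((R 0).mul (F 0))).add (p.mul ((R 0).mul (D 0)))
  · exact ((Δ 1).sub (((R 0).mul (F 1)).add ((R 1).mul (F 0)))).add
      (p.mul (((R 0).mul (D 1)).add ((R 1).mul (D 0))))
  · exact ((Δ 2).sub (((R 1).mul (F 1)).add ((R 2).mul (F 0)))).add
      (p.mul (((R 1).mul (D 1)).add ((R 2).mul (D 0))))
  · exact ((Δ 3).sub ((R 2).mul (F 1))).add (p.mul ((R 2).mul (D 1)))

attribute [irreducible] deltaPoly dPoly energyPoly gDiagPoly gPoly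

/-! ### Values of the polynomials and their leading coefficients -/

theorem evenSum_eq (ε : ℝ) (P : Fin 4 → PhasePoly) (x : Phase) :
    evenSum ε P x = MvPolynomial.eval x (P 0) + ε ^ 2 * MvPolynomial.eval x (P 1)
      + ε ^ 4 * MvPolynomial.eval x (P 2) + ε ^ 6 * MvPolynomial.eval x (P 3) := by
  simp [evenSum, Fin.sum_univ_four]

theorem RVal_eq_eval (ω : Fin 3 → ℝ) (ε : ℝ) (x : Phase) :
    RVal ω ε x = MvPolynomial.eval x (RPoly ω 0) + ε ^ 2 * MvPolynomial.eval x (RPoly ω 1)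
      + ε ^ 4 * MvPolynomial.eval x (RPoly ω 2) := by
  simp [RPoly, RVal, eval_pPoly, eval_mpPoly, eval_mPoly]
  ring

theorem SVal_eq_eval (ω : Fin 3 → ℝ) (ε : ℝ) (x : Phase) :
    SVal ω ε x = evenSum ε (SPoly ω) x := by
  simp [SPoly, SVal, evenSum_eq, eval_pPoly, eval_mpPoly, eval_mPoly]
  ring

theorem energyVal_eq_eval (ω : Fin 3 → ℝ) (ε : ℝ) (x : Phase) :
    energyVal ω ε x x = MvPolynomial.eval x (energyPoly ω 0)
      + ε ^ 2 * MvPolynomial.eval x (energyPoly ω 1) := by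
  simp [energyVal, energyPoly, eval_pPoly, eval_mPoly, cDiag, gDiag, mDot, pDot]
  ring

theorem gDiag_eq_eval (ω : Fin 3 → ℝ) (ε : ℝ) (x : Phase) (k : Fin 3) :
    gDiag ω ε x k = MvPolynomial.eval x (gDiagPoly ω k 0)
      + ε ^ 2 * MvPolynomial.eval x (gDiagPoly ω k 1) := by
  simp [gDiagPoly, eval_pPoly, gDiag]
  ring

theorem evenSum_dPoly (ω : Fin 3 → ℝ) (ε : ℝ) (x : Phase) (k : Fin 3) :
    evenSum ε (dPoly ω k) x = SVal ω ε x - ε ^ 2 * ω k * RVal ω ε x := by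
  obtain ⟨h0, h1, h2, h3⟩ := dPoly_apply ω k
  rw [SVal_eq_eval, RVal_eq_eval, evenSum_eq, evenSum_eq, h0, h1, h2, h3]
  simp only [map_sub, map_mul, MvPolynomial.eval_C]
  ring

theorem evenSum_deltaPoly (ω : Fin 3 → ℝ) (ε : ℝ) (x : Phase) :
    evenSum ε (deltaPoly ω) x = deltaVal ω ε x := by
  have h : evenSum ε (deltaPoly ω) x
      = ∑ k, MvPolynomial.eval x (mVar k * pVar k) * evenSum ε (dPoly ω k) x := by
    simp only [evenSum_eq, deltaPoly, map_sum, map_mul, Finset.mul_sum, ← Finset.sum_add_distrib]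
    exact Finset.sum_congr rfl fun k _ => by ring
  rw [h]
  simp only [evenSum_dPoly, Fin.sum_univ_three, deltaVal, mpDot, mVar, pVar]
  simp
  ring

theorem evenSum_gPoly (ω : Fin 3 → ℝ) (ε : ℝ) (x : Phase) (k : Fin 3) :
    evenSum ε (gPoly ω k) x = 2 * deltaVal ω ε x * mpDot 1 x x - RVal ω ε x * energyVal ω ε x x
      + pDot 1 x x * RVal ω ε x * gDiag ω ε x k := by
  rw [← evenSum_deltaPoly, RVal_eq_eval, energyVal_eq_eval, gDiag_eq_eval, evenSum_eq, evenSum_eq]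
  simp only [gPoly, Matrix.cons_val_zero, Matrix.cons_val_one, Matrix.cons_val, map_add, map_sub,
    map_mul, MvPolynomial.eval_C, eval_pPoly, eval_mpPoly]
  ring

theorem eval_H₃ (x : Phase) : MvPolynomial.eval x H₃ = pDot 1 x x := by
  simp [H₃, pDot, Fin.sum_univ_three, pVar]
  ring

theorem dFun_eq (ω : Fin 3 → ℝ) (ε : ℝ) (k : Fin 3) (x : Phase) :
    dFun ε (deltaPoly ω) (dPoly ω) k x = dVal ω ε x k := by
  rw [dFun, dVal, eval_H₃, evenSum_dPoly, evenSum_deltaPoly]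

theorem gFun_eq (ω : Fin 3 → ℝ) (ε : ℝ) (x : Phase) :
    gFun ω ε (deltaPoly ω) (gPoly ω) x
      = ![gVal ω ε x 0, gVal ω ε x 1, gVal ω ε x 2,
          (gVal ω ε x 1 - gVal ω ε x 2) / (ω 1 - ω 2),
          (gVal ω ε x 2 - gVal ω ε x 0) / (ω 2 - ω 0),
          (gVal ω ε x 0 - gVal ω ε x 1) / (ω 0 - ω 1)] := by
  simp only [gFun, gVal, eval_H₃, evenSum_gPoly, evenSum_deltaPoly]

theorem mem_gDom (ω : Fin 3 → ℝ) (ε : ℝ) (x : Phase) :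
    x ∈ gDom ε (deltaPoly ω) ↔ pDot 1 x x ≠ 0 ∧ deltaVal ω ε x ≠ 0 := by
  rw [gDom, Set.mem_ofPred_eq, eval_H₃, evenSum_deltaPoly]

theorem H₃_eq : H₃ = pPoly 1 := by
  simp [H₃, pPoly, sq]

theorem H₄_eq : H₄ = mpPoly 1 := by
  simp [H₄, mpPoly]

theorem H₁_eq (ω : Fin 3 → ℝ) : H₁ ω = mPoly 1 + pPoly ω := by
  simp [H₁, mPoly, pPoly, sq, Finset.sum_add_distrib]

theorem dPoly_zero (ω : Fin 3 → ℝ) (k : Fin 3) : dPoly ω k 0 = 1 := by simp [dPoly, SPoly]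

theorem dPoly_one (ω : Fin 3 → ℝ) (k : Fin 3) : dPoly ω k 1 = d2 ω k := by
  simp only [dPoly, SPoly, RPoly, d2, Matrix.cons_val_zero, Matrix.cons_val_one, mPoly, pPoly,
    Fin.sum_univ_three, e₁, map_add, map_sub, map_mul, Pi.one_apply, map_one, map_ofNat]
  fin_cases k <;> simp <;> ring

theorem deltaPoly_zero (ω : Fin 3 → ℝ) : deltaPoly ω 0 = H₄ := by
  simp [deltaPoly, dPoly_zero, H₄]

theorem deltaPoly_one (ω : Fin 3 → ℝ) : deltaPoly ω 1 = ∑ k, mVar k * pVar k * d2 ω k := by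
  simp only [deltaPoly, dPoly_one]

theorem gPoly_zero (ω : Fin 3 → ℝ) (k : Fin 3) :
    gPoly ω k 0 = 2 * H₄ ^ 2 - H₃ * H₁ ω + C (ω k) * H₃ ^ 2 := by
  simp only [gPoly, Matrix.cons_val_zero, deltaPoly_zero, RPoly, energyPoly, gDiagPoly, H₁_eq,
    ← H₃_eq, ← H₄_eq, map_ofNat]
  ring

/-! ### Iterates of the map as rational functions -/

section Hom

variable {A B : Type*} [CommRing A] [Algebra ℝ A] [CommRing B] [Algebra ℝ B]

/-- The matrix of the map, homogenized by the variable `e`. -/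
def homMatrix (ω : Fin 3 → ℝ) (ε : ℝ) (e : A) (v : Fin 6 → A) : Matrix (Fin 6) (Fin 6) A :=
  let c := algebraMap ℝ A
  let ω₂₃ := c (ε * (ω 1 - ω 2)); let ω₃₁ := c (ε * (ω 2 - ω 0)); let ω₁₂ := c (ε * (ω 0 - ω 1))
  let η := c ε
  !![e, 0, 0, 0, ω₂₃ * v 5, ω₂₃ * v 4;
     0, e, 0, ω₃₁ * v 5, 0, ω₃₁ * v 3;
     0, 0, e, ω₁₂ * v 4, ω₁₂ * v 3, 0;
     0, η * v 5, -η * v 4, e, -η * v 2, η * v 1;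
     -η * v 5, 0, η * v 3, η * v 2, e, -η * v 0;
     η * v 4, -η * v 3, 0, -η * v 1, η * v 0, e]

theorem map_homMatrix (φ : A →ₐ[ℝ] B) (ω : Fin 3 → ℝ) (ε : ℝ) (e : A) (v : Fin 6 → A) :
    (homMatrix ω ε e v).map φ = homMatrix ω ε (φ e) (fun i => φ (v i)) := by
  ext i j
  fin_cases i <;> fin_cases j <;> simp [homMatrix]

theorem homMatrix_eq_smul (ω : Fin 3 → ℝ) (ε : ℝ) {e : ℝ} (he : e ≠ 0) (v : Fin 6 → ℝ) :
    homMatrix ω ε e v = e • kahanMatrix ω ε (fun i => v i / e) := by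
  ext i j
  fin_cases i <;> fin_cases j <;> simp [homMatrix, kahanMatrix] <;> field_simp

end Hom

/-- Numerators and denominator of the `n`-th iterate. -/
noncomputable def ratIter (ω : Fin 3 → ℝ) (ε : ℝ) : ℕ → (Fin 6 → PhasePoly) × PhasePoly
  | 0 => (MvPolynomial.X, 1)
  | n + 1 =>
    let M := homMatrix ω ε (ratIter ω ε n).2 (ratIter ω ε n).1
    (M.adjugate *ᵥ (ratIter ω ε n).1, M.det)

noncomputable def iterNum (ω : Fin 3 → ℝ) (ε : ℝ) (n : ℕ) (x : Phase) : Phase :=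
  fun i => MvPolynomial.eval x ((ratIter ω ε n).1 i)

noncomputable def iterDen (ω : Fin 3 → ℝ) (ε : ℝ) (n : ℕ) (x : Phase) : ℝ :=
  MvPolynomial.eval x (ratIter ω ε n).2

noncomputable def iterVal (ω : Fin 3 → ℝ) (ε : ℝ) (n : ℕ) (x : Phase) : Phase :=
  fun i => iterNum ω ε n x i / iterDen ω ε n x

theorem iterDen_zero (ω : Fin 3 → ℝ) (ε : ℝ) (x : Phase) : iterDen ω ε 0 x = 1 := by
  simp [iterDen, ratIter]

theorem iterVal_zero (ω : Fin 3 → ℝ) (ε : ℝ) (x : Phase) : iterVal ω ε 0 x = x := by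
  ext i; simp [iterVal, iterNum, iterDen, ratIter]

theorem eval_homMatrix (ω : Fin 3 → ℝ) (ε : ℝ) (n : ℕ) (x : Phase) :
    (homMatrix ω ε (ratIter ω ε n).2 (ratIter ω ε n).1).map (MvPolynomial.eval x)
      = homMatrix ω ε (iterDen ω ε n x) (iterNum ω ε n x) := by
  have h := map_homMatrix (MvPolynomial.aeval x : PhasePoly →ₐ[ℝ] ℝ) ω ε (ratIter ω ε n).2
    (ratIter ω ε n).1
  exact h

theorem iterDen_succ' (ω : Fin 3 → ℝ) (ε : ℝ) (n : ℕ) (x : Phase) :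
    iterDen ω ε (n + 1) x = (homMatrix ω ε (iterDen ω ε n x) (iterNum ω ε n x)).det := by
  rw [← eval_homMatrix, iterDen, ratIter, RingHom.map_det]
  rfl

theorem iterNum_succ (ω : Fin 3 → ℝ) (ε : ℝ) (n : ℕ) (x : Phase) :
    iterNum ω ε (n + 1) x
      = (homMatrix ω ε (iterDen ω ε n x) (iterNum ω ε n x)).adjugate *ᵥ iterNum ω ε n x := by
  rw [← eval_homMatrix]
  ext i
  have h := RingHom.map_adjugate (MvPolynomial.eval x)
    (homMatrix ω ε (ratIter ω ε n).2 (ratIter ω ε n).1)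
  have h' : ((homMatrix ω ε (ratIter ω ε n).2 (ratIter ω ε n).1).map (MvPolynomial.eval x)).adjugate
    = (homMatrix ω ε (ratIter ω ε n).2 (ratIter ω ε n).1).adjugate.map (MvPolynomial.eval x) :=
    h.symm
  rw [h', iterNum, ratIter, RingHom.map_mulVec]
  rfl

theorem iterDen_succ (ω : Fin 3 → ℝ) (ε : ℝ) (n : ℕ) (x : Phase) (h : iterDen ω ε n x ≠ 0) :
    iterDen ω ε (n + 1) x
      = iterDen ω ε n x ^ 6 * (kahanMatrix ω ε (iterVal ω ε n x)).det := by
  rw [iterDen_succ', homMatrix_eq_smul _ _ h, Matrix.det_smul, Fintype.card_fin]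
  rfl

theorem iterVal_succ (ω : Fin 3 → ℝ) (ε : ℝ) (n : ℕ) (x : Phase) (h : iterDen ω ε n x ≠ 0)
    (h' : iterDen ω ε (n + 1) x ≠ 0) :
    kahanMatrix ω ε (iterVal ω ε n x) *ᵥ iterVal ω ε (n + 1) x = iterVal ω ε n x := by
  have e : iterVal ω ε (n + 1) x = (iterDen ω ε (n + 1) x)⁻¹ • iterNum ω ε (n + 1) x := by
    ext i; simp [iterVal, div_eq_inv_mul]
  have e' : iterVal ω ε n x = (iterDen ω ε n x)⁻¹ • iterNum ω ε n x := by
    ext i; simp [iterVal, div_eq_inv_mul]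
  have k : kahanMatrix ω ε (iterVal ω ε n x)
      = (iterDen ω ε n x)⁻¹ • homMatrix ω ε (iterDen ω ε n x) (iterNum ω ε n x) := by
    rw [homMatrix_eq_smul _ _ h, smul_smul, inv_mul_cancel₀ h, one_smul]
    rfl
  rw [k, e, iterNum_succ, Matrix.smul_mulVec, Matrix.mulVec_smul, Matrix.mulVec_mulVec,
    Matrix.mul_adjugate, ← iterDen_succ', Matrix.smul_mulVec, Matrix.one_mulVec, smul_smul,
    smul_smul, e', mul_assoc, inv_mul_cancel₀ h', mul_one]

theorem mem_iter_succ {X : Type*} (f : X →. X) (n : ℕ) (x y : X) :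
    y ∈ iter f (n + 1) x ↔ ∃ z ∈ iter f n x, y ∈ f z :=
  Part.mem_bind_iff

/-- Each new denominator is e⁶ det M at the current iterate, where e is the previous denominator. So
nonvanishing of all denominators up to n means that every step is defined. -/
theorem mem_iter_iff (ω : Fin 3 → ℝ) (ε : ℝ) (n : ℕ) (x y : Phase) :
    y ∈ iter (clebschMap ω ε) n x ↔ (∀ k ≤ n, iterDen ω ε k x ≠ 0) ∧ y = iterVal ω ε n x := by
  induction n generalizing y with
  | zero =>
    simp only [iter, PFun.id_apply, Part.mem_some_iff, iterVal_zero, Nat.le_zero, forall_eq,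
      iterDen_zero, ne_eq, one_ne_zero, not_false_eq_true, true_and]
  | succ n ih =>
    rw [mem_iter_succ]
    constructor
    · rintro ⟨z, hz, hy⟩
      obtain ⟨hk, rfl⟩ := (ih z).1 hz
      obtain ⟨hd, hy⟩ := (mem_clebschMap _ _ _ _).1 hy
      have h := hk n le_rfl
      have h' : iterDen ω ε (n + 1) x ≠ 0 := by
        rw [iterDen_succ _ _ _ _ h]
        exact mul_ne_zero (pow_ne_zero _ h) hd
      refine ⟨fun k hk' => ?_, ?_⟩
      · rcases Nat.le_succ_iff.1 hk' with h1 | rfl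
        · exact hk k h1
        · exact h'
      · have := iterVal_succ ω ε n x h h'
        exact Matrix.mulVec_injective_of_isUnit ((Matrix.isUnit_iff_isUnit_det _).2 hd.isUnit)
          (hy.trans this.symm)
    · rintro ⟨hk, rfl⟩
      have h := hk n (Nat.le_succ n)
      have h' := hk (n + 1) le_rfl
      refine ⟨_, (ih _).2 ⟨fun k hk' => hk k (hk'.trans (Nat.le_succ n)), rfl⟩, ?_⟩
      refine (mem_clebschMap _ _ _ _).2 ⟨fun h0 => h' ?_, iterVal_succ ω ε n x h h'⟩
      rw [iterDen_succ _ _ _ _ h, h0, mul_zero]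

/-- Composition of a polynomial with a rational map is, up to a denominator, a polynomial. -/
theorem exists_poly_comp (N : Fin 6 → PhasePoly) (E : PhasePoly) (q : PhasePoly) :
    ∃ (q' : PhasePoly) (k : ℕ), ∀ x, MvPolynomial.eval x E ≠ 0 →
      MvPolynomial.eval x q' = MvPolynomial.eval x E ^ k *
        MvPolynomial.eval (fun i => MvPolynomial.eval x (N i) / MvPolynomial.eval x E) q := by
  induction q using MvPolynomial.induction_on with
  | C a => exact ⟨MvPolynomial.C a, 0, fun x _ => by simp⟩
  | add p q hp hq =>
    obtain ⟨p', k, hp⟩ := hp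
    obtain ⟨q', l, hq⟩ := hq
    refine ⟨E ^ l * p' + E ^ k * q', k + l, fun x hx => ?_⟩
    simp only [map_add, map_mul, map_pow, hp x hx, hq x hx]
    ring
  | mul_X p i hp =>
    obtain ⟨p', k, hp⟩ := hp
    refine ⟨p' * N i, k + 1, fun x hx => ?_⟩
    simp only [map_mul, hp x hx, MvPolynomial.eval_X]
    field_simp
    ring

/-- The set where a nonzero polynomial does not vanish is dense. -/
theorem dense_eval_ne_zero {Q : PhasePoly} (hQ : Q ≠ 0) :
    Dense {x : Phase | MvPolynomial.eval x Q ≠ 0} := by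
  obtain ⟨z, hz⟩ : ∃ z, MvPolynomial.eval z Q ≠ 0 := by
    by_contra! h
    exact hQ (MvPolynomial.funext fun x => by simp [h x])
  intro x
  -- The restriction of Q to the line from x to z is nonzero, having the value Q(z) at t = 1. It has
  -- finitely many roots, so points arbitrarily close to x avoid them.
  let P : Polynomial ℝ := MvPolynomial.aeval
    (fun i => Polynomial.C (x i) + Polynomial.X * Polynomial.C (z i - x i)) Q
  have hP : ∀ t : ℝ, P.eval t = MvPolynomial.eval (fun i => x i + t * (z i - x i)) Q := by
    intro t
    have : P.eval t = (Polynomial.evalRingHom t) P := rfl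
    rw [this, MvPolynomial.map_aeval]
    have hid : (Polynomial.evalRingHom t).comp (algebraMap ℝ (Polynomial ℝ)) = RingHom.id ℝ := by
      ext; simp
    rw [hid]
    refine congrArg (fun g => MvPolynomial.eval₂Hom (RingHom.id ℝ) g Q) (funext fun i => ?_)
    simp
  have hP0 : P ≠ 0 := by
    intro h
    apply hz
    have := hP 1
    rw [h, Polynomial.eval_zero] at this
    simpa using this.symm
  have hfin : {t : ℝ | P.eval t = 0}.Finite := by
    refine P.roots.toFinset.finite_toSet.subset fun t ht => ?_
    simpa [hP0] using ht
  have hev : ∀ᶠ t in nhdsWithin (0 : ℝ) {0}ᶜ, P.eval t ≠ 0 := by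
    have : {t : ℝ | P.eval t = 0}ᶜ ∈ Filter.cofinite := hfin.compl_mem_cofinite
    exact nhdsNE_le_cofinite 0 this
  have ht : Filter.Tendsto (fun t : ℝ => (fun i => x i + t * (z i - x i) : Phase))
      (nhdsWithin (0 : ℝ) {0}ᶜ) (nhds x) := by
    have hc : Continuous (fun t : ℝ => (fun i => x i + t * (z i - x i) : Phase)) := by fun_prop
    have := (hc.tendsto 0).mono_left (nhdsWithin_le_nhds (s := {0}ᶜ))
    simpa using this
  refine mem_closure_of_tendsto ht ?_
  filter_upwards [hev] with t h
  rw [← hP]; exact h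

theorem continuousAt_iterVal (ω : Fin 3 → ℝ) (ε : ℝ) (n : ℕ) (x : Phase)
    (h : iterDen ω ε n x ≠ 0) : ContinuousAt (iterVal ω ε n) x := by
  refine continuousAt_pi.2 fun i => ContinuousAt.div ?_ ?_ h
  · exact (MvPolynomial.continuous_eval _).continuousAt
  · exact (MvPolynomial.continuous_eval _).continuousAt

/-- A function which is preserved by the map between generic points is preserved along the orbit
segments of all points outside the zero set of a polynomial. -/
theorem exists_poly_invariant (ω : Fin 3 → ℝ) (ε : ℝ) {V : Type*} (v : Phase → V) (q : PhasePoly)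
    (z : Phase) (hz : z ∈ clebschMap ω ε z) (hq : MvPolynomial.eval z q ≠ 0)
    (hv : ∀ x y, MvPolynomial.eval x q ≠ 0 → MvPolynomial.eval y q ≠ 0 → y ∈ clebschMap ω ε x →
      v y = v x) (n : ℕ) :
    ∃ Q : PhasePoly, Q ≠ 0 ∧ ∀ x, MvPolynomial.eval x Q ≠ 0 →
      MvPolynomial.eval x q ≠ 0 ∧ MvPolynomial.eval (iterVal ω ε n x) q ≠ 0 ∧
      v (iterVal ω ε n x) = v x := by
  have hfix : ∀ n, z ∈ iter (clebschMap ω ε) n z := by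
    intro n
    induction n with
    | zero => simp [iter, PFun.id_apply]
    | succ n ih => exact (mem_iter_succ _ _ _ _).2 ⟨z, ih, hz⟩
  choose q' l hq' using fun k => exists_poly_comp (ratIter ω ε k).1 (ratIter ω ε k).2 q
  -- The factors are the denominator of the k-th iterate and q along that iterate cleared of
  -- denominators. None vanishes at z, whose iterates are all equal to z.
  refine ⟨∏ k ∈ Finset.range (n + 1), ((ratIter ω ε k).2 * q' k), fun h0 => ?_, fun x hx => ?_⟩
  · have h1 : MvPolynomial.eval z (∏ k ∈ Finset.range (n + 1), ((ratIter ω ε k).2 * q' k)) = 0 := by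
      rw [h0, map_zero]
    rw [map_prod, Finset.prod_eq_zero_iff] at h1
    obtain ⟨k, -, hk⟩ := h1
    obtain ⟨h2, h3⟩ := (mem_iter_iff ω ε k z z).1 (hfix k)
    have h4 : MvPolynomial.eval z (ratIter ω ε k).2 ≠ 0 := h2 k le_rfl
    rw [map_mul, hq' k z h4] at hk
    rcases mul_eq_zero.1 hk with hk | hk
    · exact h4 hk
    · refine mul_ne_zero (pow_ne_zero _ h4) ?_ hk
      change MvPolynomial.eval (iterVal ω ε k z) q ≠ 0
      rwa [← h3]
  · have hE : ∀ k ≤ n, iterDen ω ε k x ≠ 0 ∧ MvPolynomial.eval (iterVal ω ε k x) q ≠ 0 := by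
      intro k hk
      rw [map_prod, Finset.prod_ne_zero_iff] at hx
      have := hx k (Finset.mem_range.2 (Nat.lt_succ_of_le hk))
      rw [map_mul] at this
      have h1 := left_ne_zero_of_mul this
      have h2 := right_ne_zero_of_mul this
      rw [hq' k x h1] at h2
      exact ⟨h1, right_ne_zero_of_mul h2⟩
    have hx0 := (hE 0 (Nat.zero_le n)).2
    rw [iterVal_zero] at hx0
    refine ⟨hx0, (hE n le_rfl).2, ?_⟩
    have key : ∀ k ≤ n, v (iterVal ω ε k x) = v x := by
      intro k
      induction k with
      | zero => intro _; rw [iterVal_zero]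
      | succ k ih =>
        intro hk
        rw [← ih (Nat.le_of_succ_le hk)]
        have h1 := hE k (Nat.le_of_succ_le hk)
        have h2 := hE (k + 1) hk
        refine hv _ _ h1.2 h2.2 ((mem_clebschMap _ _ _ _).2 ⟨fun h0 => h2.1 ?_, ?_⟩)
        · rw [iterDen_succ _ _ _ _ h1.1, h0, mul_zero]
        · exact iterVal_succ _ _ _ _ h1.1 h2.1
    exact key n le_rfl

/-! ### Generic points -/

/-- Polynomial functions on the phase space. -/
def IsPoly (f : Phase → ℝ) : Prop := ∃ p : PhasePoly, ∀ x, MvPolynomial.eval x p = f x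

namespace IsPoly

variable {f g : Phase → ℝ}

theorem eval (p : PhasePoly) : IsPoly fun x => MvPolynomial.eval x p := ⟨p, fun _ => rfl⟩

theorem const (a : ℝ) : IsPoly fun _ => a := ⟨MvPolynomial.C a, fun _ => by simp⟩

theorem coord (i : Fin 6) : IsPoly fun x => x i := ⟨MvPolynomial.X i, fun _ => by simp⟩

theorem add (hf : IsPoly f) (hg : IsPoly g) : IsPoly fun x => f x + g x := by
  obtain ⟨p, hp⟩ := hf
  obtain ⟨q, hq⟩ := hg
  exact ⟨p + q, fun x => by rw [map_add, hp, hq]⟩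

theorem sub (hf : IsPoly f) (hg : IsPoly g) : IsPoly fun x => f x - g x := by
  obtain ⟨p, hp⟩ := hf
  obtain ⟨q, hq⟩ := hg
  exact ⟨p - q, fun x => by rw [map_sub, hp, hq]⟩

theorem mul (hf : IsPoly f) (hg : IsPoly g) : IsPoly fun x => f x * g x := by
  obtain ⟨p, hp⟩ := hf
  obtain ⟨q, hq⟩ := hg
  exact ⟨p * q, fun x => by rw [map_mul, hp, hq]⟩

theorem pow (hf : IsPoly f) (n : ℕ) : IsPoly fun x => f x ^ n := by
  obtain ⟨p, hp⟩ := hf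
  exact ⟨p ^ n, fun x => by rw [map_pow, hp]⟩

theorem continuous (hf : IsPoly f) : Continuous f := by
  obtain ⟨p, hp⟩ := hf
  have : f = fun x => MvPolynomial.eval x p := funext fun x => (hp x).symm
  rw [this]
  exact MvPolynomial.continuous_eval p

end IsPoly

theorem isPoly_pDot (w : Fin 3 → ℝ) : IsPoly fun x => pDot w x x :=
  ⟨pPoly w, eval_pPoly w⟩

theorem isPoly_evenSum (ε : ℝ) (P : Fin 4 → PhasePoly) : IsPoly (evenSum ε P) := by
  have : evenSum ε P = fun x => MvPolynomial.eval x (P 0) + ε ^ 2 * MvPolynomial.eval x (P 1)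
      + ε ^ 4 * MvPolynomial.eval x (P 2) + ε ^ 6 * MvPolynomial.eval x (P 3) :=
    funext fun x => evenSum_eq ε P x
  rw [this]
  exact (((IsPoly.eval _).add ((IsPoly.const _).mul (IsPoly.eval _))).add
    ((IsPoly.const _).mul (IsPoly.eval _))).add ((IsPoly.const _).mul (IsPoly.eval _))

theorem isPoly_deltaVal (ω : Fin 3 → ℝ) (ε : ℝ) : IsPoly (deltaVal ω ε) := by
  have : deltaVal ω ε = evenSum ε (deltaPoly ω) := funext fun x => (evenSum_deltaPoly ω ε x).symm
  rw [this]
  exact isPoly_evenSum _ _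

theorem isPoly_RVal (ω : Fin 3 → ℝ) (ε : ℝ) : IsPoly (RVal ω ε) := by
  have : RVal ω ε = _ := funext fun x => RVal_eq_eval ω ε x
  rw [this]
  exact ((IsPoly.eval _).add ((IsPoly.const _).mul (IsPoly.eval _))).add
    ((IsPoly.const _).mul (IsPoly.eval _))

theorem isPoly_cDiag (ω : Fin 3 → ℝ) (ε : ℝ) (k : Fin 3) : IsPoly fun x => cDiag ω ε x k :=
  ((IsPoly.const 1).sub ((IsPoly.const _).mul (isPoly_pDot ω))).add
    (((IsPoly.const _).mul (isPoly_pDot 1)).mul (IsPoly.const _))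

theorem isPoly_axialVec (ω : Fin 3 → ℝ) (ε : ℝ) (k : Fin 3) :
    IsPoly fun x => axialVec ω ε x k := by
  have h : ∀ (a b : ℝ) (i j l : Fin 6), IsPoly fun x : Phase => ε * x i + a * b * x j * x l :=
    fun a b i j l => ((IsPoly.const ε).mul (IsPoly.coord i)).add
      (((IsPoly.const (a * b)).mul (IsPoly.coord j)).mul (IsPoly.coord l))
  match k with
  | 0 => exact h _ _ _ _ _
  | 1 => exact h _ _ _ _ _
  | 2 => exact h _ _ _ _ _

theorem isPoly_redDet (ω : Fin 3 → ℝ) (ε : ℝ) : IsPoly (redDet ω ε) := by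
  have c := isPoly_cDiag ω ε
  have u := isPoly_axialVec ω ε
  exact (((((c 0).mul (c 1)).mul (c 2)).add ((c 0).mul ((u 0).pow 2))).add
    ((c 1).mul ((u 1).pow 2))).add ((c 2).mul ((u 2).pow 2))

theorem exists_genericPoly (ω : Fin 3 → ℝ) (ε : ℝ) :
    ∃ q : PhasePoly, ∀ x, MvPolynomial.eval x q ≠ 0 ↔ Generic ω ε x := by
  obtain ⟨q, hq⟩ := ((((isPoly_pDot 1).mul (isPoly_deltaVal ω ε)).mul (isPoly_RVal ω ε)).mul
    (isPoly_redDet ω ε)).mul (isPoly_redDet ω (-ε))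
  refine ⟨q, fun x => ?_⟩
  rw [hq x]
  simp only [ne_eq, mul_eq_zero, not_or]
  exact ⟨fun ⟨⟨⟨⟨a, b⟩, c⟩, d⟩, e⟩ => ⟨a, b, c, d, e⟩,
    fun ⟨a, b, c, d, e⟩ => ⟨⟨⟨⟨a, b⟩, c⟩, d⟩, e⟩⟩

/-- A generic fixed point. -/
theorem exists_generic_fixedPoint (ω : Fin 3 → ℝ) {ε : ℝ} (hε : ε ≠ 0) :
    ∃ z, Generic ω ε z ∧ z ∈ clebschMap ω ε z := by
  -- The fixed point has m and p along the first axis. There c is the product of the last two C_k,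
  -- the first being 1, and R = D = c + ε² b²; b is chosen large enough to make this nonzero.
  set c : ℝ := (1 - ε ^ 2 * ω 0 + ε ^ 2 * ω 1) * (1 - ε ^ 2 * ω 0 + ε ^ 2 * ω 2) with hc
  set b : ℝ := (1 + |c|) / ε with hb
  have hb0 : b ≠ 0 := div_ne_zero (by positivity) hε
  have hD : c + ε ^ 2 * b ^ 2 ≠ 0 := by
    have h1 : ε ^ 2 * b ^ 2 = (1 + |c|) ^ 2 := by rw [hb]; field_simp
    rw [h1]
    have := abs_nonneg c
    have := neg_abs_le c
    nlinarith
  clear_value b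
  let z : Phase := ![b, 0, 0, 1, 0, 0]
  have hp : ∀ w, pDot w z z = w 0 := fun w => by simp [pDot, z]
  have hq : ∀ w, mpDot w z z = w 0 * b := fun w => by simp [mpDot, z]
  have hs : ∀ w, mDot w z z = w 0 * b ^ 2 := fun w => by simp [mDot, z]; ring
  have hR : RVal ω ε z = c + ε ^ 2 * b ^ 2 := by
    simp only [RVal, hp, hq, hs, Pi.one_apply, Pi.pow_apply, e₁, e₂, hc]; ring
  have hdet : ∀ η : ℝ, η ^ 2 = ε ^ 2 → redDet ω η z = c + ε ^ 2 * b ^ 2 := by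
    intro η hη
    simp [redDet, cDiag, axialVec, hp, z, hη, hc, mul_pow]
  refine ⟨z, ⟨by simp [hp], ?_, by rwa [hR], by rwa [hdet ε rfl], by rwa [hdet _ (neg_sq ε)]⟩, ?_⟩
  · have : deltaVal ω ε z = (c + ε ^ 2 * b ^ 2) * b := by
      simp only [deltaVal, hR, SVal, hp, hq, hs, Pi.one_apply, Pi.pow_apply, e₁, e₂, e₃, hc]; ring
    rw [this]
    exact mul_ne_zero hD hb0
  · refine (mem_clebschMap _ _ _ _).2 ⟨fun h0 => ?_, ?_⟩
    · obtain ⟨v, hv0, hv⟩ := Matrix.exists_mulVec_eq_zero_iff.2 h0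
      apply hv0
      have k0 := congrFun hv 0
      have k1 := congrFun hv 1
      have k2 := congrFun hv 2
      have k3 := congrFun hv 3
      have k4 := congrFun hv 4
      have k5 := congrFun hv 5
      simp [kahanMatrix, dotProduct, Fin.sum_univ_succ, z]
        at k0 k1 k2 k3 k4 k5
      have e4 : (c + ε ^ 2 * b ^ 2) * v 4 = 0 := by
        rw [hc]
        linear_combination (1 - ε ^ 2 * ω 0 + ε ^ 2 * ω 2) * (k4 - ε * k2)
          + ε * b * (k5 + ε * k1)
      have e5 : (c + ε ^ 2 * b ^ 2) * v 5 = 0 := by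
        rw [hc]
        linear_combination (1 - ε ^ 2 * ω 0 + ε ^ 2 * ω 1) * (k5 + ε * k1)
          - ε * b * (k4 - ε * k2)
      have v4 := (mul_eq_zero.1 e4).resolve_left hD
      have v5 := (mul_eq_zero.1 e5).resolve_left hD
      ext i
      fin_cases i <;> simp_all
    · rw [← step_iff]
      constructor <;> simp [z]

/-! ### Orbit relations by density -/

theorem eq_zero_of_continuousAt {Q : PhasePoly} (hQ : Q ≠ 0) {h : Phase → ℝ} {x : Phase}
    (hc : ContinuousAt h x) (h0 : ∀ y, MvPolynomial.eval y Q ≠ 0 → h y = 0) : h x = 0 := by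
  have hx := dense_eval_ne_zero hQ x
  rw [mem_closure_iff_nhdsWithin_neBot] at hx
  have h1 := hc.tendsto.mono_left (nhdsWithin_le_nhds (s := {y | MvPolynomial.eval y Q ≠ 0}))
  refine tendsto_nhds_unique h1 (Filter.Tendsto.congr' ?_ tendsto_const_nhds)
  filter_upwards [self_mem_nhdsWithin] with y hy
  exact (h0 y hy).symm

/-- Along orbits, a relation with coefficients which are generically preserved persists. -/
theorem orbit_relation (ω : Fin 3 → ℝ) {ε : ℝ} (hε : ε ≠ 0) {l : ℕ} (v : Phase → Fin l → ℝ)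
    (φ : Fin l → Phase → ℝ) (hφ : ∀ j, Continuous (φ j))
    (hv : ∀ x y, Generic ω ε x → Generic ω ε y → Step ω ε x y → v y = v x)
    (hself : ∀ x, Generic ω ε x → ∑ j, v x j * φ j x = 0) (n : ℕ) (x y : Phase)
    (hx : ∀ j, ContinuousAt (fun x => v x j) x) (hy : y ∈ iter (clebschMap ω ε) n x) :
    ∑ j, v x j * φ j y = 0 := by
  obtain ⟨hk, rfl⟩ := (mem_iter_iff _ _ _ _ _).1 hy
  obtain ⟨q, hq⟩ := exists_genericPoly ω ε
  obtain ⟨z, hz, hfix⟩ := exists_generic_fixedPoint ω hε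
  obtain ⟨Q, hQ, hQ'⟩ := exists_poly_invariant ω ε v q z hfix ((hq z).2 hz)
    (fun x y hx hy hxy => hv x y ((hq x).1 hx) ((hq y).1 hy)
      ((step_iff _ _ _ _).2 ((mem_clebschMap _ _ _ _).1 hxy).2)) n
  refine eq_zero_of_continuousAt hQ (h := fun x => ∑ j, v x j * φ j (iterVal ω ε n x)) ?_ ?_
  · refine tendsto_finsetSum _ fun j _ => Filter.Tendsto.mul (hx j) ?_
    exact (hφ j).continuousAt.comp (continuousAt_iterVal ω ε n x (hk n le_rfl))
  · intro y hy
    obtain ⟨-, h2, h3⟩ := hQ' y hy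
    have := hself _ ((hq _).1 h2)
    rwa [h3] at this

/-- A generically preserved function is preserved wherever it is continuous. -/
theorem integral_of_generic (ω : Fin 3 → ℝ) {ε : ℝ} (hε : ε ≠ 0) (v : Phase → ℝ)
    (hv : ∀ x y, Generic ω ε x → Generic ω ε y → Step ω ε x y → v y = v x) (x y : Phase)
    (hx : ContinuousAt v x) (hy : ContinuousAt v y) (hxy : y ∈ clebschMap ω ε x) :
    v y = v x := by
  have h1 : y ∈ iter (clebschMap ω ε) 1 x :=
    (mem_iter_succ _ _ _ _).2 ⟨x, (mem_iter_iff _ _ 0 _ _).2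
      ⟨fun k hk => by rw [Nat.le_zero.1 hk, iterDen_zero]; exact one_ne_zero,
        (iterVal_zero _ _ _).symm⟩, hxy⟩
  obtain ⟨hk, rfl⟩ := (mem_iter_iff _ _ _ _ _).1 h1
  obtain ⟨q, hq⟩ := exists_genericPoly ω ε
  obtain ⟨z, hz, hfix⟩ := exists_generic_fixedPoint ω hε
  obtain ⟨Q, hQ, hQ'⟩ := exists_poly_invariant ω ε v q z hfix ((hq z).2 hz)
    (fun x y hx hy hxy => hv x y ((hq x).1 hx) ((hq y).1 hy)
      ((step_iff _ _ _ _).2 ((mem_clebschMap _ _ _ _).1 hxy).2)) 1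
  have := eq_zero_of_continuousAt hQ (h := fun x => v (iterVal ω ε 1 x) - v x) (x := x)
    ((ContinuousAt.comp hy (continuousAt_iterVal ω ε 1 x (hk 1 le_rfl))).sub hx)
    (fun y hy => sub_eq_zero.2 (hQ' y hy).2.2)
  exact sub_eq_zero.1 this

/-! ### The relations for `Ψ` and `Θ` -/

theorem continuousAt_dVal (ω : Fin 3 → ℝ) (ε : ℝ) (x : Phase) (h : deltaVal ω ε x ≠ 0)
    (k : Fin 3) : ContinuousAt (fun x => dVal ω ε x k) x := by
  have e : (fun x => dVal ω ε x k)
      = fun x => pDot 1 x x * evenSum ε (dPoly ω k) x / deltaVal ω ε x :=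
    funext fun x => by rw [dVal, evenSum_dPoly]
  rw [e]
  exact ((isPoly_pDot 1).mul (isPoly_evenSum _ _)).continuous.continuousAt.div
    (isPoly_deltaVal ω ε).continuous.continuousAt h

theorem continuousAt_gVal (ω : Fin 3 → ℝ) (ε : ℝ) (x : Phase) (h₀ : pDot 1 x x ≠ 0)
    (h : deltaVal ω ε x ≠ 0) (k : Fin 3) : ContinuousAt (fun x => gVal ω ε x k) x := by
  have e : (fun x => gVal ω ε x k)
      = fun x => evenSum ε (gPoly ω k) x / (2 * pDot 1 x x * deltaVal ω ε x) :=
    funext fun x => by rw [gVal, evenSum_gPoly]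
  rw [e]
  exact (isPoly_evenSum _ _).continuous.continuousAt.div
    (((IsPoly.const 2).mul (isPoly_pDot 1)).mul (isPoly_deltaVal ω ε)).continuous.continuousAt
    (mul_ne_zero (mul_ne_zero two_ne_zero h₀) h)

/-- The null-vector of `Ψ`. -/
noncomputable def psiVec (ω : Fin 3 → ℝ) (ε : ℝ) (x : Phase) : Fin 6 → ℝ :=
  ![-1, -1, -1, dVal ω ε x 0, dVal ω ε x 1, dVal ω ε x 2]

/-- The null-vector of `Θ` in terms of `g₁, g₂, g₃`. -/
noncomputable def thetaVecOf (ω g : Fin 3 → ℝ) : Fin 7 → ℝ :=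
  ![g 0, g 1, g 2, (g 1 - g 2) / (ω 1 - ω 2), (g 2 - g 0) / (ω 2 - ω 0),
    (g 0 - g 1) / (ω 0 - ω 1), -1]

noncomputable def thetaVec (ω : Fin 3 → ℝ) (ε : ℝ) (x : Phase) : Fin 7 → ℝ :=
  thetaVecOf ω (gVal ω ε x)

theorem snoc_gFun (ω : Fin 3 → ℝ) (ε : ℝ) (x : Phase) :
    (Fin.snoc (gFun ω ε (deltaPoly ω) (gPoly ω) x) (-1) : Fin 7 → ℝ) = thetaVec ω ε x := by
  rw [gFun_eq]
  ext i
  fin_cases i <;> rfl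

theorem sum_psiVec_mul (ω : Fin 3 → ℝ) (ε : ℝ) (x : Phase) (h : deltaVal ω ε x ≠ 0) :
    ∑ j, psiVec ω ε x j * Psi j x = 0 := by
  simp only [psiVec, Psi, Fin.sum_univ_succ, Fin.sum_univ_zero, Matrix.cons_val_zero,
    Matrix.cons_val_succ, dVal]
  field_simp
  simp only [deltaVal, pDot, mpDot, Pi.one_apply]
  ring

/-- Only the G_k term depends on the index, and G_i - G_j = (ω_i - ω_j) C_k. Thus the coefficients
of m_k² in the null-vector are R C_k / (2Δ). -/
theorem gVal_sub (ω : Fin 3 → ℝ) (ε : ℝ) (x : Phase) (h₀ : pDot 1 x x ≠ 0)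
    (h : deltaVal ω ε x ≠ 0) (i j k : Fin 3) (hij : ω i - ω j ≠ 0)
    (hk : coDiag ω i - coDiag ω j = ω k * (ω j - ω i)) :
    (gVal ω ε x i - gVal ω ε x j) / (ω i - ω j)
      = RVal ω ε x * cDiag ω ε x k / (2 * deltaVal ω ε x) := by
  have e : gDiag ω ε x i - gDiag ω ε x j = (ω i - ω j) * cDiag ω ε x k := by
    simp only [gDiag, cDiag]
    linear_combination (-ε ^ 2 * pDot 1 x x) * hk
  simp only [gVal]
  rw [← sub_div, div_div, div_eq_div_iff (mul_ne_zero (mul_ne_zero (mul_ne_zero two_ne_zero h₀) h)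
    hij) (mul_ne_zero two_ne_zero h)]
  linear_combination (2 * deltaVal ω ε x * pDot 1 x x * RVal ω ε x) * e

/-- The g_k p_k² sum to m · p - R (E - p · Gp) / (2Δ), the m_k² terms to R (m · Cm) / (2Δ), and E =
m · Cm + p · Gp. -/
theorem sum_thetaVec_mul (ω : Fin 3 → ℝ) (hω : Function.Injective ω) (ε : ℝ) (x : Phase)
    (h₀ : pDot 1 x x ≠ 0) (h : deltaVal ω ε x ≠ 0) :
    ∑ j, thetaVec ω ε x j * Theta j x = 0 := by
  have hne : ∀ i j : Fin 3, i ≠ j → ω i - ω j ≠ 0 := fun i j hij =>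
    sub_ne_zero.2 (hω.ne hij)
  simp only [thetaVec, thetaVecOf]
  rw [gVal_sub ω ε x h₀ h 1 2 0 (hne _ _ (by decide)) (by simp [coDiag]; ring),
    gVal_sub ω ε x h₀ h 2 0 1 (hne _ _ (by decide)) (by simp [coDiag]; ring),
    gVal_sub ω ε x h₀ h 0 1 2 (hne _ _ (by decide)) (by simp [coDiag]; ring)]
  simp only [Theta, Fin.sum_univ_succ, Fin.sum_univ_zero, Matrix.cons_val_zero,
    Matrix.cons_val_succ, gVal]
  have e1 : energyVal ω ε x x = cDiag ω ε x 0 * x 0 ^ 2 + cDiag ω ε x 1 * x 1 ^ 2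
      + cDiag ω ε x 2 * x 2 ^ 2 + (gDiag ω ε x 0 * x 3 ^ 2 + gDiag ω ε x 1 * x 4 ^ 2
      + gDiag ω ε x 2 * x 5 ^ 2) := by
    simp only [energyVal, mDot, pDot.eq_1 (gDiag ω ε x)]; ring
  have e2 : pDot 1 x x = x 3 ^ 2 + x 4 ^ 2 + x 5 ^ 2 := by simp only [pDot, Pi.one_apply]; ring
  have e3 : mpDot 1 x x = x 0 * x 3 + x 1 * x 4 + x 2 * x 5 := by
    simp only [mpDot, Pi.one_apply]; ring
  field_simp
  rw [e1, e3, e2]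
  ring

theorem continuous_Psi (j : Fin 6) : Continuous (Psi j) := by
  fin_cases j <;> simp [Psi] <;> fun_prop

theorem continuous_Theta (j : Fin 7) : Continuous (Theta j) := by
  fin_cases j <;> simp [Theta] <;> fun_prop

theorem psiVec_neg (ω : Fin 3 → ℝ) (ε : ℝ) : psiVec ω (-ε) = psiVec ω ε := by
  ext x j; simp only [psiVec, dVal_neg]

theorem thetaVec_neg (ω : Fin 3 → ℝ) (ε : ℝ) : thetaVec ω (-ε) = thetaVec ω ε := by
  ext x j; simp only [thetaVec, gVal_neg]

theorem continuousAt_psiVec (ω : Fin 3 → ℝ) (ε : ℝ) (x : Phase) (h : deltaVal ω ε x ≠ 0)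
    (j : Fin 6) : ContinuousAt (fun x => psiVec ω ε x j) x := by
  have := continuousAt_dVal ω ε x h
  fin_cases j
  · exact continuousAt_const
  · exact continuousAt_const
  · exact continuousAt_const
  · exact this 0
  · exact this 1
  · exact this 2

theorem continuousAt_thetaVec (ω : Fin 3 → ℝ) (ε : ℝ) (x : Phase) (h₀ : pDot 1 x x ≠ 0)
    (h : deltaVal ω ε x ≠ 0) (j : Fin 7) : ContinuousAt (fun x => thetaVec ω ε x j) x := by
  have c := continuousAt_gVal ω ε x h₀ h
  fin_cases j
  · exact c 0
  · exact c 1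
  · exact c 2
  · exact ((c 1).sub (c 2)).div_const _
  · exact ((c 2).sub (c 0)).div_const _
  · exact ((c 0).sub (c 1)).div_const _
  · exact continuousAt_const

theorem mem_clebschNullSpace_iff (ω : Fin 3 → ℝ) (ε : ℝ) {l : ℕ} (φ : Fin l → Phase → ℝ)
    (x : Phase) (c : Fin l → ℝ) :
    c ∈ clebschNullSpace ω ε φ x ↔
      (∀ n, ∀ y ∈ iter (clebschMap ω ε) n x, ∑ j, c j * φ j y = 0) ∧
      ∀ n, ∀ y ∈ iter (clebschMap ω (-ε)) (n + 1) x, ∑ j, c j * φ j y = 0 :=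
  ⟨fun h => ⟨fun n y hy => h (Int.ofNat n) y hy, fun n y hy => h (Int.negSucc n) y hy⟩,
    fun h i => match i with
      | Int.ofNat n => h.1 n
      | Int.negSucc n => h.2 n⟩

theorem psiVec_mem (ω : Fin 3 → ℝ) {ε : ℝ} (hε : ε ≠ 0) (x : Phase) (h : deltaVal ω ε x ≠ 0) :
    psiVec ω ε x ∈ clebschNullSpace ω ε Psi x := by
  have key : ∀ η : ℝ, η ≠ 0 → deltaVal ω η x ≠ 0 → ∀ n, ∀ y ∈ iter (clebschMap ω η) n x,
      ∑ j, psiVec ω η x j * Psi j y = 0 := fun η hη hd n y hy =>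
    orbit_relation ω hη (psiVec ω η) Psi continuous_Psi
      (fun x y hx hy hxy => by ext j; simp only [psiVec, hxy.dVal_eq hx hy])
      (fun x hx => sum_psiVec_mul ω η x hx.delta) n x y
      (continuousAt_psiVec ω η x hd) hy
  refine (mem_clebschNullSpace_iff _ _ _ _ _).2 ⟨key ε hε h, fun n => ?_⟩
  rw [← psiVec_neg]
  exact key (-ε) (neg_ne_zero.2 hε) (by rwa [deltaVal_neg]) (n + 1)

theorem thetaVec_mem (ω : Fin 3 → ℝ) (hω : Function.Injective ω) {ε : ℝ} (hε : ε ≠ 0)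
    (x : Phase) (h₀ : pDot 1 x x ≠ 0) (h : deltaVal ω ε x ≠ 0) :
    thetaVec ω ε x ∈ clebschNullSpace ω ε Theta x := by
  have key : ∀ η : ℝ, η ≠ 0 → deltaVal ω η x ≠ 0 → ∀ n, ∀ y ∈ iter (clebschMap ω η) n x,
      ∑ j, thetaVec ω η x j * Theta j y = 0 := fun η hη hd n y hy =>
    orbit_relation ω hη (thetaVec ω η) Theta continuous_Theta
      (fun x y hx hy hxy => by simp only [thetaVec, hxy.gVal_eq hη hx hy])
      (fun x hx => sum_thetaVec_mul ω hω η x hx.normSq hx.delta) n x y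
      (continuousAt_thetaVec ω η x h₀ hd) hy
  refine (mem_clebschNullSpace_iff _ _ _ _ _).2 ⟨key ε hε h, fun n => ?_⟩
  rw [← thetaVec_neg]
  exact key (-ε) (neg_ne_zero.2 hε) (by rwa [deltaVal_neg]) (n + 1)

theorem thetaVec_eq (ω : Fin 3 → ℝ) {ε : ℝ} (hε : ε ≠ 0) (x y : Phase)
    (hx₀ : pDot 1 x x ≠ 0) (hx : deltaVal ω ε x ≠ 0) (hy₀ : pDot 1 y y ≠ 0)
    (hy : deltaVal ω ε y ≠ 0) (hxy : y ∈ clebschMap ω ε x) (j : Fin 7) :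
    thetaVec ω ε y j = thetaVec ω ε x j :=
  integral_of_generic ω hε (fun x => thetaVec ω ε x j)
    (fun x y hx hy hxy => by simp only [thetaVec, hxy.gVal_eq hε hx hy]) x y
    (continuousAt_thetaVec ω ε x hx₀ hx j) (continuousAt_thetaVec ω ε y hy₀ hy j) hxy

theorem thetaVec_castSucc (ω : Fin 3 → ℝ) (ε : ℝ) (x : Phase) (j : Fin 6) :
    thetaVec ω ε x j.castSucc = gFun ω ε (deltaPoly ω) (gPoly ω) x j := by
  rw [← snoc_gFun, Fin.snoc_castSucc]

/-! ### The Hirota–Kimura property of Θ at every point -/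

theorem linearIndependent_Theta : LinearIndependent ℝ Theta := by
  rw [Fintype.linearIndependent_iff]
  intro g hg
  have key : ∀ x : Phase, ∑ j, g j * Theta j x = 0 := fun x => by
    have := congrFun hg x
    simpa [Finset.sum_apply] using this
  have k0 := key ![0, 0, 0, 1, 0, 0]
  have k1 := key ![0, 0, 0, 0, 1, 0]
  have k2 := key ![0, 0, 0, 0, 0, 1]
  have k3 := key ![1, 0, 0, 0, 0, 0]
  have k4 := key ![0, 1, 0, 0, 0, 0]
  have k5 := key ![0, 0, 1, 0, 0, 0]
  have k6 := key ![1, 0, 0, 1, 0, 0]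
  simp only [Theta, Fin.sum_univ_succ, Fin.sum_univ_zero, Matrix.cons_val_zero,
    Matrix.cons_val_succ, Matrix.cons_val_one, Matrix.cons_val] at k0 k1 k2 k3 k4 k5 k6
  intro i
  fin_cases i
  · simpa using k0
  · simpa using k1
  · simpa using k2
  · simpa using k3
  · simpa using k4
  · simpa using k5
  · simp at k0 k3 k6
    simpa [k0, k3] using k6

theorem continuous_iterDen (ω : Fin 3 → ℝ) (ε : ℝ) (n : ℕ) : Continuous (iterDen ω ε n) :=
  MvPolynomial.continuous_eval (ratIter ω ε n).2

theorem eventually_mem_iter (ω : Fin 3 → ℝ) (ε : ℝ) (n : ℕ) (x : Phase)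
    (hk : ∀ k ≤ n, iterDen ω ε k x ≠ 0) :
    ∀ᶠ y in nhds x, iterVal ω ε n y ∈ iter (clebschMap ω ε) n y := by
  have h : ∀ k ∈ Finset.range (n + 1), ∀ᶠ y in nhds x, iterDen ω ε k y ≠ 0 := fun k hkn =>
    (continuous_iterDen ω ε k).continuousAt.eventually_ne
      (hk k (Nat.lt_succ_iff.1 (Finset.mem_range.1 hkn)))
  filter_upwards [(Filter.eventually_all_finset _).2 h] with y hy
  exact (mem_iter_iff _ _ _ _ _).2
    ⟨fun k hkn => hy k (Finset.mem_range.2 (Nat.lt_succ_of_le hkn)), rfl⟩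

theorem isHKBasis_Theta (ω : Fin 3 → ℝ) (hω : Function.Injective ω) {ε : ℝ} (hε : ε ≠ 0) :
    IsHKBasis (clebschMap ω ε) (clebschMap ω (-ε)) Theta := by
  refine ⟨linearIndependent_Theta, fun x => ?_⟩
  obtain ⟨q, hq⟩ := exists_genericPoly ω ε
  obtain ⟨z, hz, -⟩ := exists_generic_fixedPoint ω hε
  have hq0 : q ≠ 0 := by
    rintro rfl
    exact (hq z).2 hz (map_zero _)
  have hx := dense_eval_ne_zero hq0 x
  rw [mem_closure_iff_nhdsWithin_neBot] at hx
  -- An ultrafilter of generic points tending to x: along it the unit null-vectors converge on the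
  -- compact sphere. Their limit is nonzero and inherits the relation at every iterate defined at x.
  let F : Ultrafilter Phase := Ultrafilter.of (nhdsWithin x {y | MvPolynomial.eval y q ≠ 0})
  have hF : (F : Filter Phase) ≤ nhdsWithin x {y | MvPolynomial.eval y q ≠ 0} :=
    Ultrafilter.of_le _
  have hFx : (F : Filter Phase) ≤ nhds x := hF.trans nhdsWithin_le_nhds
  have hFg : ∀ᶠ y in (F : Filter Phase), Generic ω ε y := by
    filter_upwards [hF self_mem_nhdsWithin] with y hy
    exact (hq y).1 hy
  let u : Phase → Fin 7 → ℝ := fun y => ‖thetaVec ω ε y‖⁻¹ • thetaVec ω ε y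
  have hne : ∀ y, ‖thetaVec ω ε y‖ ≠ 0 := fun y h0 => by
    have := congrFun (norm_eq_zero.1 h0) 6
    simp [thetaVec, thetaVecOf] at this
  have hu : ∀ y, u y ∈ Metric.sphere (0 : Fin 7 → ℝ) 1 := fun y => by
    simp [u, norm_smul, inv_mul_cancel₀ (hne y)]
  obtain ⟨c, hc, hlim⟩ := (isCompact_sphere (0 : Fin 7 → ℝ) 1).ultrafilter_le_nhds (F.map u)
    (by
      rw [Ultrafilter.coe_map, Filter.le_principal_iff]
      exact Filter.mem_map.2 (Filter.univ_mem' hu))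
  have hlim' : Filter.Tendsto u F (nhds c) := hlim
  refine ⟨c, ?_, fun h0 => by simp [h0] at hc⟩
  have hmem : ∀ᶠ y in (F : Filter Phase), u y ∈ clebschNullSpace ω ε Theta y := by
    filter_upwards [hFg] with y hy
    exact Submodule.smul_mem _ _ (thetaVec_mem ω hω hε y hy.normSq hy.delta)
  have key : ∀ η : ℝ, (∀ᶠ y in (F : Filter Phase), ∀ n, ∀ z ∈ iter (clebschMap ω η) n y,
      ∑ j, u y j * Theta j z = 0) → ∀ n, ∀ z ∈ iter (clebschMap ω η) n x,
      ∑ j, c j * Theta j z = 0 := by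
    intro η hη n z hzx
    obtain ⟨hk, rfl⟩ := (mem_iter_iff _ _ _ _ _).1 hzx
    have h1 : Filter.Tendsto (fun y => ∑ j, u y j * Theta j (iterVal ω η n y)) F
        (nhds (∑ j, c j * Theta j (iterVal ω η n x))) := by
      refine tendsto_finsetSum _ fun j _ => ?_
      refine ((continuous_apply j).continuousAt.tendsto.comp hlim').mul ?_
      exact ((continuous_Theta j).continuousAt.comp
        (continuousAt_iterVal ω η n x (hk n le_rfl))).tendsto.mono_left hFx
    refine tendsto_nhds_unique h1 (Filter.Tendsto.congr' ?_ tendsto_const_nhds)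
    filter_upwards [hη, hFx (eventually_mem_iter ω η n x hk)] with y h2 h3
    exact (h2 n _ h3).symm
  refine (mem_clebschNullSpace_iff _ _ _ _ _).2 ⟨key ε ?_, fun n => key (-ε) ?_ (n + 1)⟩
  · filter_upwards [hmem] with y hy
    exact ((mem_clebschNullSpace_iff _ _ _ _ _).1 hy).1
  · filter_upwards [hmem] with y hy n
    -- Negative powers start at -1; the 0-th iterate of the backward map is the identity and is
    -- covered by the forward half.
    cases n with
    | zero =>
      intro z hz
      rw [mem_iter_iff, iterVal_zero] at hz
      refine ((mem_clebschNullSpace_iff _ _ _ _ _).1 hy).1 0 z ((mem_iter_iff _ _ _ _ _).2 ⟨?_, ?_⟩)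
      · intro k hk
        rw [Nat.le_zero.1 hk, iterDen_zero]
        exact one_ne_zero
      · rw [iterVal_zero]
        exact hz.2
    | succ n => exact ((mem_clebschNullSpace_iff _ _ _ _ _).1 hy).2 n

/-! ### A degenerate limit of the map with explicit orbits -/

/-- The quadratic function `m · C m + p · G p`. -/
def diagEnergy (C G : Fin 3 → ℝ) (x : Phase) : ℝ := mDot C x x + pDot G x x

/-- The increment of a quadratic integral of the continuous flow along the map, in the coordinates
rescaled by `(s, √s, √s, 1, √s, √s)`, when `G = diag (0, a, b)`. -/
def energyIncr (a b s : ℝ) (v w : Phase) : ℝ :=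
  (v 4 * w 2 - v 5 * w 1 + w 4 * v 2 - w 5 * v 1)
      * (v 1 * b * w 5 - v 2 * a * w 4 - w 1 * b * v 5 + w 2 * a * v 4)
    + (s * (v 5 * w 0 + w 5 * v 0) - v 3 * w 2 - w 3 * v 2) * (w 0 * b * v 5 - v 0 * b * w 5)
    + (v 3 * w 1 + w 3 * v 1 - s * (v 4 * w 0 + w 4 * v 0)) * (v 0 * a * w 4 - w 0 * a * v 4)

/-- The rescaling of the coordinates by `(δ², δ, δ, 1, δ, δ)`. -/
def rescale (δ : ℝ) (v : Phase) : Phase := ![δ ^ 2 * v 0, δ * v 1, δ * v 2, v 3, δ * v 4, δ * v 5]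

/-- The three conditions say that the form is an integral of the continuous flow. Hence the
lower-order terms of its increment cancel, leaving a quartic expression, which rescales by δ⁴. -/
theorem Step.diagEnergy_sub {ω C : Fin 3 → ℝ} {a b : ℝ} {x y : Phase} (h : Step ω 1 x y)
    (h₀ : C 0 * (ω 2 - ω 1) = b - a) (h₁ : C 1 * (ω 0 - ω 2) = -b)
    (h₂ : C 2 * (ω 1 - ω 0) = a) :
    diagEnergy C ![0, a, b] y - diagEnergy C ![0, a, b] x = energyIncr a b 1 x y := by
  obtain ⟨e0, e1, e2, e3, e4, e5⟩ := h
  simp only [diagEnergy, mDot, pDot, energyIncr, Matrix.cons_val_zero,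
    Matrix.cons_val_one, Matrix.cons_val]
  linear_combination C 0 * (x 0 + y 0) * e0 + C 1 * (x 1 + y 1) * e1 + C 2 * (x 2 + y 2) * e2
    + (x 1 * b * y 5 - x 2 * a * y 4 - y 1 * b * x 5 + y 2 * a * x 4) * e3
    + (a * (x 4 + y 4) + (y 0 * b * x 5 - x 0 * b * y 5)) * e4
    + (b * (x 5 + y 5) + (x 0 * a * y 4 - y 0 * a * x 4)) * e5
    + (x 0 + y 0) * (x 4 * y 5 + x 5 * y 4) * h₀
    + (x 1 + y 1) * (x 5 * y 3 + x 3 * y 5) * h₁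
    + (x 2 + y 2) * (x 3 * y 4 + x 4 * y 3) * h₂

theorem energyIncr_rescale (a b δ : ℝ) (v w : Phase) :
    energyIncr a b 1 (rescale δ v) (rescale δ w) = δ ^ 4 * energyIncr a b (δ ^ 2) v w := by
  simp only [energyIncr, rescale, Matrix.cons_val_zero, Matrix.cons_val_one, Matrix.cons_val]
  ring

/-- The frequencies of the normalized system. -/
noncomputable def stdFreq (t : ℝ) : Fin 3 → ℝ := ![0, -1 / 4, -t ^ 2]

/-- The matrix of the map in rescaled coordinates, `s = δ²`. -/
noncomputable def rescaledMatrix (t s : ℝ) (v : Phase) : Matrix (Fin 6) (Fin 6) ℝ :=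
  !![1, 0, 0, 0, (t ^ 2 - 1 / 4) * v 5, (t ^ 2 - 1 / 4) * v 4;
     0, 1, 0, -t ^ 2 * v 5, 0, -t ^ 2 * v 3;
     0, 0, 1, 1 / 4 * v 4, 1 / 4 * v 3, 0;
     0, s * v 5, -s * v 4, 1, -s * v 2, s * v 1;
     -s * v 5, 0, v 3, v 2, 1, -s * v 0;
     s * v 4, -v 3, 0, -v 1, s * v 0, 1]

theorem kahanMatrix_mulVec_rescale (t δ : ℝ) (v w : Phase) :
    kahanMatrix (stdFreq t) 1 (rescale δ v) *ᵥ rescale δ w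
      = rescale δ (rescaledMatrix t (δ ^ 2) v *ᵥ w) := by
  ext i
  fin_cases i <;>
    simp [kahanMatrix, rescaledMatrix, rescale, stdFreq, Matrix.mulVec, dotProduct, Fin.sum_univ_succ] <;> ring

/-- The explicit orbit of the limit `s = 0`. -/
noncomputable def limitOrbit (t : ℝ) (i : ℕ) : Phase :=
  let μ := (1 + t) / (1 - t)
  let L := (3 : ℝ) ^ i; let L' := (1 / 3 : ℝ) ^ i; let N := μ ^ i
  ![1 + (1 / 2 - t) * (1 - t / 2) * N * L - (1 / 2 + t) * (1 + t / 2) * N * L',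
    t * N, -(L - L') / 2, 1, L + L', N]

/-- At s = 0, p₁ stays 1 and the pairs (m₂, p₃) and (m₃, p₂) decouple into linear systems with
eigenvalues ±t and ±1/2. Their discrete multipliers are (1 + λ) / (1 - λ), that is μ^(±1) and
3^(±1), and m₁ is obtained by summing products of p₂ and p₃. -/
theorem limitOrbit_succ {t : ℝ} (ht : t < 1 / 2) (i : ℕ) :
    rescaledMatrix t 0 (limitOrbit t i) *ᵥ limitOrbit t (i + 1) = limitOrbit t i := by
  have h : (1 - t) ≠ 0 := by linarith
  ext j
  simp only [limitOrbit, pow_succ]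
  generalize (3 : ℝ) ^ i = L
  generalize (1 / 3 : ℝ) ^ i = L'
  generalize ((1 + t) / (1 - t)) ^ i = N
  fin_cases j <;>
    simp [rescaledMatrix, Matrix.mulVec, dotProduct, Fin.sum_univ_succ] <;> field_simp <;> ring

theorem det_rescaledMatrix_limitOrbit {t : ℝ} (ht₀ : 0 < t) (ht : t < 1 / 2) (i : ℕ) :
    (rescaledMatrix t 0 (limitOrbit t i)).det ≠ 0 := by
  intro h0
  obtain ⟨v, hv, h⟩ := Matrix.exists_mulVec_eq_zero_iff.2 h0
  apply hv
  have h3 : limitOrbit t i 3 = 1 := rfl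
  have k := fun j => congrFun h j
  have k0 := k 0
  have k1 := k 1
  have k2 := k 2
  have k3 := k 3
  have k4 := k 4
  have k5 := k 5
  simp [rescaledMatrix, Matrix.mulVec, dotProduct, Fin.sum_univ_succ, h3] at k0 k1 k2 k3 k4 k5
  rw [k3] at k1 k2 k4 k5
  have j1 : v 1 = 0 := by
    have h1 : (1 - t ^ 2) ≠ 0 := by nlinarith
    have h2 : (1 - t ^ 2) * v 1 = 0 := by linear_combination k1 + t ^ 2 * k5
    exact (mul_eq_zero.1 h2).resolve_left h1
  have j2 : v 2 = 0 := by linear_combination 4 / 3 * k2 - 1 / 3 * k4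
  rw [j1] at k5
  rw [j2] at k4
  have j5 : v 5 = 0 := by linear_combination k5
  have j4 : v 4 = 0 := by linear_combination k4
  rw [j4, j5] at k0
  ext j
  fin_cases j
  · simpa using k0
  · exact j1
  · exact j2
  · exact k3
  · exact j4
  · exact j5

/-! ### Independence in the limit -/

/-- The growth rates of the products of coordinates along the limit orbit. -/
noncomputable def modeRate (μ : ℝ) : Fin 7 → ℝ :=
  ![(1 / 3) ^ 2, μ ^ 2 * (1 / 3) ^ 2, μ * (1 / 3), μ ^ 2, μ * 3, 3 ^ 2, μ ^ 2 * 3 ^ 2]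

/-- The rates are listed in increasing order for 1 < μ < 3, which is where 0 < t < 1/2 enters. -/
theorem modeRate_injective {μ : ℝ} (h₁ : 1 < μ) (h₃ : μ < 3) :
    Function.Injective (modeRate μ) := by
  have h : 1 < μ ^ 2 := by nlinarith
  refine StrictMono.injective (Fin.strictMono_iff_lt_succ.2 fun i => ?_)
  fin_cases i <;> simp [modeRate, -one_lt_sq_iff_one_lt_abs] <;> nlinarith

theorem modes_eq_zero {μ : ℝ} (h₁ : 1 < μ) (h₃ : μ < 3) (c : Fin 7 → ℝ)
    (h : ∀ i : Fin 7, ∑ j, c j * modeRate μ j ^ (i : ℕ) = 0) : c = 0 :=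
  Matrix.eq_zero_of_forall_pow_sum_mul_pow_eq_zero (modeRate_injective h₁ h₃) h

theorem sum_mul_modeRate_pow (μ : ℝ) (c : Fin 7 → ℝ) (i : ℕ) :
    ∑ j, c j * modeRate μ j ^ i = c 0 * ((1 / 3 : ℝ) ^ i) ^ 2
      + c 1 * ((μ ^ i) ^ 2 * ((1 / 3 : ℝ) ^ i) ^ 2) + c 2 * (μ ^ i * (1 / 3 : ℝ) ^ i)
      + c 3 * (μ ^ i) ^ 2 + c 4 * (μ ^ i * 3 ^ i) + c 5 * (3 ^ i) ^ 2
      + c 6 * ((μ ^ i) ^ 2 * (3 ^ i) ^ 2) := by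
  rw [Fin.sum_univ_seven]
  simp only [modeRate, Matrix.cons_val_zero, Matrix.cons_val_one, Matrix.cons_val, mul_pow,
    ← pow_mul, mul_comm i]

/-- The functions which are combinations of the squares of the coordinates along orbits of the
rescaled map. -/
noncomputable def adaptedFun (t s : ℝ) (u : ℕ → Phase) : Fin 6 → ℕ → ℝ :=
  ![fun _ => 1, fun i => u i 4 ^ 2, fun i => u i 5 ^ 2, fun i => u i 0 ^ 2,
    fun i => ∑ l ∈ Finset.range i, energyIncr (-1 / 4) (-t ^ 2) s (u l) (u (l + 1)),
    fun i => ∑ l ∈ Finset.range i, energyIncr (t ^ 2 / 4) (t ^ 2 / 4) s (u l) (u (l + 1))]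

theorem energyIncr_limit {a b t μ k k' L L' N : ℝ} (hμ : t * (1 + μ) = μ - 1) (hL : L * L' = 1) :
    energyIncr a b 0 ![1 + k * N * L - k' * N * L', t * N, -(L - L') / 2, 1, L + L', N]
      ![1 + k * (N * μ) * (L * 3) - k' * (N * μ) * (L' * (1 / 3)), t * (N * μ),
        -(L * 3 - L' * (1 / 3)) / 2, 1, L * 3 + L' * (1 / 3), N * μ]
      = -8 / 9 * a * L' ^ 2 + (k' / 3 * (μ - 1) ^ 2 * a - 4 / 9 * μ * k' * b) * (N ^ 2 * L' ^ 2)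
        - 2 / 3 * (μ - 1) * (a - b) * (N * L')
        + (16 / 3 * a * t * μ - 4 / 3 * μ * (k - k') * b
          + (μ - 1) * (k / 3 - 3 * k' - 3 * μ * k + μ * k' / 3) * a) * N ^ 2
        + 2 * (μ - 1) * (a - b) * (N * L) + 8 * a * L ^ 2
        + (4 * μ * k * b - 3 * k * (μ - 1) ^ 2 * a) * (N ^ 2 * L ^ 2) := by
  simp only [energyIncr, Matrix.cons_val_zero, Matrix.cons_val_one, Matrix.cons_val]
  linear_combination N * ((1 + k * N * L - k' * N * L') * a * (L * 3 + L' * (1 / 3))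
      - (1 + k * (N * μ) * (L * 3) - k' * (N * μ) * (L' * (1 / 3))) * a * (L + L')) * hμ
    + (-8 / 3 * a * (-3 * L ^ 2 + L' ^ 2 / 3 - 2 * t * μ * N ^ 2)
      - 4 / 3 * μ * (k - k') * b * N ^ 2
      + (μ - 1) * N ^ 2 * a * (k / 3 - 3 * k' - 3 * μ * k + μ * k' / 3)) * hL

theorem energyIncr_limitOrbit {t μ : ℝ} (ht : t < 1 / 2) (hμ : μ = (1 + t) / (1 - t))
    (a b : ℝ) (i : ℕ) (k k' : ℝ) (hk : k = (1 / 2 - t) * (1 - t / 2))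
    (hk' : k' = (1 / 2 + t) * (1 + t / 2)) :
    energyIncr a b 0 (limitOrbit t i) (limitOrbit t (i + 1)) =
      ∑ j, ![-8 / 9 * a, k' / 3 * (μ - 1) ^ 2 * a - 4 / 9 * μ * k' * b,
        -2 / 3 * (μ - 1) * (a - b),
        16 / 3 * a * t * μ - 4 / 3 * μ * (k - k') * b
          + (μ - 1) * (k / 3 - 3 * k' - 3 * μ * k + μ * k' / 3) * a,
        2 * (μ - 1) * (a - b), 8 * a, 4 * μ * k * b - 3 * k * (μ - 1) ^ 2 * a] j
        * modeRate μ j ^ i := by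
  have h : (1 - t) ≠ 0 := by linarith
  have h1 : t * (1 + μ) = μ - 1 := by rw [hμ]; field_simp; ring
  have hL : (3 : ℝ) ^ i * (1 / 3 : ℝ) ^ i = 1 := by rw [← mul_pow]; norm_num
  rw [sum_mul_modeRate_pow]
  simp only [limitOrbit, pow_succ _ i, ← hμ, ← hk, ← hk']
  rw [energyIncr_limit h1 hL]
  simp only [Matrix.cons_val_zero, Matrix.cons_val_one, Matrix.cons_val]
  ring

theorem adaptedFun_limitOrbit_sub {t μ : ℝ} (hμ : μ = (1 + t) / (1 - t))
    (k k' : ℝ) (hk : k = (1 / 2 - t) * (1 - t / 2)) (hk' : k' = (1 / 2 + t) * (1 + t / 2))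
    (i : ℕ) :
    (limitOrbit t (i + 1) 4 ^ 2 - limitOrbit t i 4 ^ 2
      = ∑ j, ![-8 / 9, 0, 0, 0, 0, 8, 0] j * modeRate μ j ^ i) ∧
    (limitOrbit t (i + 1) 5 ^ 2 - limitOrbit t i 5 ^ 2
      = ∑ j, ![0, 0, 0, μ ^ 2 - 1, 0, 0, 0] j * modeRate μ j ^ i) ∧
    (limitOrbit t (i + 1) 0 ^ 2 - limitOrbit t i 0 ^ 2
      = ∑ j, ![0, k' ^ 2 * (μ ^ 2 / 9 - 1), -2 * k' * (μ / 3 - 1), -2 * k * k' * (μ ^ 2 - 1),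
          2 * k * (3 * μ - 1), 0, k ^ 2 * (9 * μ ^ 2 - 1)] j * modeRate μ j ^ i) := by
  have hL : (3 : ℝ) ^ i * (1 / 3 : ℝ) ^ i = 1 := by rw [← mul_pow]; norm_num
  simp only [sum_mul_modeRate_pow]
  simp only [limitOrbit, pow_succ _ i, ← hμ, ← hk, ← hk', Matrix.cons_val_zero,
    Matrix.cons_val_one, Matrix.cons_val]
  generalize (3 : ℝ) ^ i = L at *
  generalize (1 / 3 : ℝ) ^ i = L' at *
  generalize μ ^ i = N at *
  refine ⟨?_, ?_, ?_⟩
  · ring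
  · ring
  · linear_combination -2 * k * k' * (μ ^ 2 - 1) * N ^ 2 * hL

theorem eq_zero_of_adaptedFun_limitOrbit {t : ℝ} (ht₀ : 0 < t) (ht : t < 1 / 2) (c : Fin 6 → ℝ)
    (h : ∀ i < 8, ∑ j, c j * adaptedFun t 0 (limitOrbit t) j i = 0) : c = 0 := by
  obtain ⟨μ, hμ⟩ : ∃ μ, μ = (1 + t) / (1 - t) := ⟨_, rfl⟩
  obtain ⟨k, hk⟩ : ∃ k, k = (1 / 2 - t) * (1 - t / 2) := ⟨_, rfl⟩
  obtain ⟨k', hk'⟩ : ∃ k', k' = (1 / 2 + t) * (1 + t / 2) := ⟨_, rfl⟩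
  have h1t : 0 < 1 - t := by linarith
  have hμ₁ : 1 < μ := by rw [hμ, lt_div_iff₀ h1t]; linarith
  have hμ₃ : μ < 3 := by rw [hμ, div_lt_iff₀ h1t]; linarith
  have hμt : μ * (1 - t) = 1 + t := by rw [hμ]; field_simp
  have hk0 : 0 < k := by rw [hk]; exact mul_pos (by linarith) (by linarith)
  have hk0' : 0 < k' := by rw [hk']; exact mul_pos (by linarith) (by linarith)
  -- Subtracting consecutive relations removes the constant function. Eight points give seven
  -- differences, exactly enough for seven modes.
  have hd := modes_eq_zero hμ₁ hμ₃ (fun j =>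
    c 1 * ![-8 / 9, 0, 0, 0, 0, 8, 0] j + c 2 * ![0, 0, 0, μ ^ 2 - 1, 0, 0, 0] j
    + c 3 * ![0, k' ^ 2 * (μ ^ 2 / 9 - 1), -2 * k' * (μ / 3 - 1), -2 * k * k' * (μ ^ 2 - 1),
          2 * k * (3 * μ - 1), 0, k ^ 2 * (9 * μ ^ 2 - 1)] j
    + c 4 * ![-8 / 9 * (-1 / 4), k' / 3 * (μ - 1) ^ 2 * (-1 / 4) - 4 / 9 * μ * k' * (-t ^ 2),
        -2 / 3 * (μ - 1) * (-1 / 4 - -t ^ 2),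
        16 / 3 * (-1 / 4) * t * μ - 4 / 3 * μ * (k - k') * (-t ^ 2)
          + (μ - 1) * (k / 3 - 3 * k' - 3 * μ * k + μ * k' / 3) * (-1 / 4),
        2 * (μ - 1) * (-1 / 4 - -t ^ 2), 8 * (-1 / 4),
        4 * μ * k * (-t ^ 2) - 3 * k * (μ - 1) ^ 2 * (-1 / 4)] j
    + c 5 * ![-8 / 9 * (t ^ 2 / 4), k' / 3 * (μ - 1) ^ 2 * (t ^ 2 / 4)
          - 4 / 9 * μ * k' * (t ^ 2 / 4),
        -2 / 3 * (μ - 1) * (t ^ 2 / 4 - t ^ 2 / 4),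
        16 / 3 * (t ^ 2 / 4) * t * μ - 4 / 3 * μ * (k - k') * (t ^ 2 / 4)
          + (μ - 1) * (k / 3 - 3 * k' - 3 * μ * k + μ * k' / 3) * (t ^ 2 / 4),
        2 * (μ - 1) * (t ^ 2 / 4 - t ^ 2 / 4), 8 * (t ^ 2 / 4),
        4 * μ * k * (t ^ 2 / 4) - 3 * k * (μ - 1) ^ 2 * (t ^ 2 / 4)] j) (fun i => by
    have h0 := h i (by omega)
    have h1 := h (i + 1) (by omega)
    obtain ⟨e1, e2, e3⟩ := adaptedFun_limitOrbit_sub hμ k k' hk hk' i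
    have e4 := energyIncr_limitOrbit ht hμ (-1 / 4) (-t ^ 2) i k k' hk hk'
    have e5 := energyIncr_limitOrbit ht hμ (t ^ 2 / 4) (t ^ 2 / 4) i k k' hk hk'
    simp only [Fin.sum_univ_six, adaptedFun, Matrix.cons_val_zero, Matrix.cons_val_one,
      Matrix.cons_val, Finset.sum_range_succ] at h0 h1
    simp only [add_mul, Finset.sum_add_distrib, mul_assoc (c _), ← Finset.mul_sum]
    rw [← e1, ← e2, ← e3, ← e4, ← e5]
    linear_combination h1 - h0)
  have g := fun j => congrFun hd j
  have g2 := g 2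
  have g3 := g 3
  have g4 := g 4
  have g5 := g 5
  have g6 := g 6
  clear g hd
  simp only [Matrix.cons_val, Pi.zero_apply,
    mul_zero, add_zero, zero_add] at g2 g3 g4 g5 g6
  have hk3 : k * (3 * μ - 1) + k' * (3 - μ) ≠ 0 :=
    (add_pos (mul_pos hk0 (by linarith)) (mul_pos hk0' (by linarith))).ne'
  have c3 : c 3 = 0 := by
    have : (k * (3 * μ - 1) + k' * (3 - μ)) * c 3 = 0 := by
      -- In the modes μ/3 and 3μ the fifth coefficient is absent because a = b, and the fourth
      -- cancels in this combination.
      linear_combination 1 / 2 * g4 + 3 / 2 * g2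
    exact (mul_eq_zero.1 this).resolve_left hk3
  have hD : (μ - 1) * (t ^ 2 - 1 / 4) ≠ 0 := mul_ne_zero (by linarith) (by nlinarith)
  have c4 : c 4 = 0 := by
    rw [c3] at g4
    have : ((μ - 1) * (t ^ 2 - 1 / 4)) * c 4 = 0 := by linear_combination 1 / 2 * g4
    exact (mul_eq_zero.1 this).resolve_left hD
  have c5 : c 5 = 0 := by
    rw [c3, c4] at g6
    have h2 : (1 - t) ^ 2 * (4 * μ - 3 * (μ - 1) ^ 2) = 4 * (1 - 4 * t ^ 2) := by
      rw [hμ]; field_simp; ring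
    have h3 : 4 * μ - 3 * (μ - 1) ^ 2 ≠ 0 := by
      intro h0
      rw [h0] at h2
      nlinarith
    have : (k * (t ^ 2 / 4) * (4 * μ - 3 * (μ - 1) ^ 2)) * c 5 = 0 := by linear_combination g6
    exact (mul_eq_zero.1 this).resolve_left (mul_ne_zero (by positivity) h3)
  have c1 : c 1 = 0 := by
    rw [c4, c5] at g5
    linear_combination 1 / 8 * g5
  have c2 : c 2 = 0 := by
    rw [c3, c4, c5] at g3
    have : (μ ^ 2 - 1) * c 2 = 0 := by linear_combination g3
    exact (mul_eq_zero.1 this).resolve_left (by nlinarith)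
  have c0 : c 0 = 0 := by
    have := h 0 (by norm_num)
    simpa [Fin.sum_univ_six, c1, c2, c3, c4, c5, adaptedFun] using this
  ext j
  fin_cases j <;> assumption

/-! ### Orbits along which the squares of the coordinates are independent -/

/-- There is an orbit segment along which the squares of the coordinates are independent. -/
def HasIndepOrbit (ω : Fin 3 → ℝ) (ε : ℝ) : Prop :=
  ∃ u : ℕ → Phase, (∀ i < 8, kahanMatrix ω ε (u i) *ᵥ u (i + 1) = u i) ∧
    (∀ i < 8, (kahanMatrix ω ε (u i)).det ≠ 0) ∧
    LinearIndependent ℝ (fun (j : Fin 6) (i : Fin 8) => u i j ^ 2)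

/-- The orbit of `v` under the rescaled map. -/
noncomputable def rescaledOrbit (t : ℝ) (v : Phase) : ℕ → ℝ → Phase
  | 0 => fun _ => v
  | i + 1 => fun δ =>
    (rescaledMatrix t (δ ^ 2) (rescaledOrbit t v i δ)).det⁻¹ •
      ((rescaledMatrix t (δ ^ 2) (rescaledOrbit t v i δ)).adjugate *ᵥ rescaledOrbit t v i δ)

theorem mulVec_det_inv_smul_adjugate {A : Matrix (Fin 6) (Fin 6) ℝ} (h : A.det ≠ 0)
    (v : Fin 6 → ℝ) : A *ᵥ (A.det⁻¹ • (A.adjugate *ᵥ v)) = v := by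
  rw [Matrix.mulVec_smul, Matrix.mulVec_mulVec, Matrix.mul_adjugate, Matrix.smul_mulVec,
    Matrix.one_mulVec, smul_smul, inv_mul_cancel₀ h, one_smul]

theorem rescaledOrbit_zero {t : ℝ} (ht₀ : 0 < t) (ht : t < 1 / 2) (i : ℕ) :
    rescaledOrbit t (limitOrbit t 0) i 0 = limitOrbit t i := by
  induction i with
  | zero => rfl
  | succ i ih =>
    have h := det_rescaledMatrix_limitOrbit ht₀ ht i
    simp only [rescaledOrbit, ih, zero_pow two_ne_zero]
    exact Matrix.mulVec_injective_of_isUnit ((Matrix.isUnit_iff_isUnit_det _).2 h.isUnit)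
      ((mulVec_det_inv_smul_adjugate h _).trans (limitOrbit_succ ht i).symm)

theorem continuous_rescaledMatrix (t : ℝ) :
    Continuous fun q : ℝ × Phase => rescaledMatrix t (q.1 ^ 2) q.2 := by
  refine continuous_matrix fun i j => ?_
  fin_cases i <;> fin_cases j <;> simp [rescaledMatrix] <;> fun_prop

theorem continuousAt_rescaledOrbit {t : ℝ} (ht₀ : 0 < t) (ht : t < 1 / 2) (i : ℕ) :
    ContinuousAt (rescaledOrbit t (limitOrbit t 0) i) 0 := by
  induction i with
  | zero => exact continuousAt_const
  | succ i ih =>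
    have h := det_rescaledMatrix_limitOrbit ht₀ ht i
    have hq : ContinuousAt (fun δ => (δ, rescaledOrbit t (limitOrbit t 0) i δ)) 0 :=
      continuousAt_id.prodMk ih
    have hM := continuous_rescaledMatrix t
    have hdet := hM.matrix_det.continuousAt.comp' hq
    have hmul := (hM.matrix_adjugate.matrix_mulVec continuous_snd).continuousAt.comp' hq
    refine (hdet.inv₀ ?_).smul hmul
    rw [rescaledOrbit_zero ht₀ ht, zero_pow two_ne_zero]
    exact h

theorem eventually_det_rescaledOrbit {t : ℝ} (ht₀ : 0 < t) (ht : t < 1 / 2) (i : ℕ) :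
    ∀ᶠ δ in nhds (0 : ℝ),
      (rescaledMatrix t (δ ^ 2) (rescaledOrbit t (limitOrbit t 0) i δ)).det ≠ 0 := by
  have hA := (continuous_rescaledMatrix t).matrix_det.continuousAt.comp'
    (continuousAt_id.prodMk (continuousAt_rescaledOrbit ht₀ ht i))
  refine hA.eventually_ne ?_
  simp only [id, rescaledOrbit_zero ht₀ ht, zero_pow two_ne_zero]
  exact det_rescaledMatrix_limitOrbit ht₀ ht i

theorem continuous_energyIncr (a b : ℝ) :
    Continuous fun q : ℝ × Phase × Phase => energyIncr a b (q.1 ^ 2) q.2.1 q.2.2 := by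
  unfold energyIncr
  fun_prop

theorem continuousAt_energyIncr (a b : ℝ) {f g : ℝ → Phase} {x : ℝ} (hf : ContinuousAt f x)
    (hg : ContinuousAt g x) : ContinuousAt (fun δ => energyIncr a b (δ ^ 2) (f δ) (g δ)) x := by
  have h : ContinuousAt (fun δ => (δ, f δ, g δ)) x := continuousAt_id.prodMk (hf.prodMk hg)
  exact ContinuousAt.comp (f := fun δ => (δ, f δ, g δ)) (continuous_energyIncr a b).continuousAt h

theorem continuousAt_adaptedFun (t : ℝ) {u : ℕ → ℝ → Phase} {x : ℝ}
    (hu : ∀ l, ContinuousAt (u l) x) (j : Fin 6) (i : ℕ) :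
    ContinuousAt (fun δ => adaptedFun t (δ ^ 2) (fun l => u l δ) j i) x := by
  have hc : ∀ l j, ContinuousAt (fun δ => u l δ j) x := fun l j => continuousAt_pi.1 (hu l) j
  fin_cases j <;> simp only [adaptedFun, Fin.zero_eta, Fin.mk_one, Fin.reduceFinMk,
    Matrix.cons_val_zero, Matrix.cons_val_one, Matrix.cons_val]
  · exact continuousAt_const
  · exact (hc i 4).pow 2
  · exact (hc i 5).pow 2
  · exact (hc i 0).pow 2
  · exact tendsto_finsetSum _ fun l _ => continuousAt_energyIncr _ _ (hu l) (hu (l + 1))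
  · exact tendsto_finsetSum _ fun l _ => continuousAt_energyIncr _ _ (hu l) (hu (l + 1))

theorem linearIndependent_adaptedFun_zero {t : ℝ} (ht₀ : 0 < t) (ht : t < 1 / 2) :
    LinearIndependent ℝ (fun (j : Fin 6) (i : Fin 8) => adaptedFun t 0 (limitOrbit t) j i) := by
  rw [Fintype.linearIndependent_iff]
  intro c hc0
  refine congrFun (eq_zero_of_adaptedFun_limitOrbit ht₀ ht c fun i hi8 => ?_)
  have := congrFun hc0 ⟨i, hi8⟩
  rw [Finset.sum_apply] at this
  exact this

theorem eventually_linearIndependent_adaptedFun {t : ℝ} (ht₀ : 0 < t) (ht : t < 1 / 2) :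
    ∀ᶠ δ in nhds (0 : ℝ), LinearIndependent ℝ (fun (j : Fin 6) (i : Fin 8) =>
      adaptedFun t (δ ^ 2) (fun l => rescaledOrbit t (limitOrbit t 0) l δ) j i) := by
  have hcont : ContinuousAt (fun (δ : ℝ) (j : Fin 6) (i : Fin 8) =>
      adaptedFun t (δ ^ 2) (fun l => rescaledOrbit t (limitOrbit t 0) l δ) j i) 0 :=
    continuousAt_pi.2 fun j => continuousAt_pi.2 fun i =>
      continuousAt_adaptedFun t (continuousAt_rescaledOrbit ht₀ ht) j i
  have h0 : (fun (j : Fin 6) (i : Fin 8) => adaptedFun t (0 ^ 2)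
      (fun l => rescaledOrbit t (limitOrbit t 0) l 0) j i)
        ∈ {f : Fin 6 → Fin 8 → ℝ | LinearIndependent ℝ f} := by
    simp only [rescaledOrbit_zero ht₀ ht, zero_pow two_ne_zero]
    exact linearIndependent_adaptedFun_zero ht₀ ht
  exact hcont (isOpen_setOfPred_linearIndependent.mem_nhds h0)

/-! ### Independence of the squares for the normalized frequencies -/

theorem sum_cDiag_mul_sq (ω : Fin 3 → ℝ) (ε : ℝ) (x : Phase) :
    cDiag ω ε x 0 * x 3 ^ 2 + cDiag ω ε x 1 * x 4 ^ 2 + cDiag ω ε x 2 * x 5 ^ 2 = pDot 1 x x := by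
  simp only [cDiag, pDot, Pi.one_apply]
  ring

/-- The integral `∑ c_k p_k²`, where the `c_k` are constant along orbits. -/
theorem sum_cDiag_mul_sq_of_step {ω : Fin 3 → ℝ} {ε : ℝ} {u : ℕ → Phase} {n : ℕ}
    (hu : ∀ i < n, Step ω ε (u i) (u (i + 1))) (h₀ : ∀ i < n, pDot 1 (u i) (u i) ≠ 0)
    {i : ℕ} (hi : i < n) :
    cDiag ω ε (u 0) 0 * u i 3 ^ 2 + cDiag ω ε (u 0) 1 * u i 4 ^ 2 + cDiag ω ε (u 0) 2 * u i 5 ^ 2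
      = pDot 1 (u 0) (u 0) := by
  have key : ∀ k, cDiag ω ε (u i) k * pDot 1 (u 0) (u 0)
      = cDiag ω ε (u 0) k * pDot 1 (u i) (u i) := by
    induction i with
    | zero => exact fun k => rfl
    | succ i ih =>
      intro k
      have hi' := Nat.lt_of_succ_lt hi
      have h1 := (hu i hi').cDiag_mul k
      have h2 := ih hi' k
      refine mul_right_cancel₀ (h₀ i hi') ?_
      linear_combination pDot 1 (u 0) (u 0) * h1 + pDot 1 (u (i + 1)) (u (i + 1)) * h2
  refine mul_right_cancel₀ (h₀ i hi) ?_
  linear_combination -u i 3 ^ 2 * key 0 - u i 4 ^ 2 * key 1 - u i 5 ^ 2 * key 2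
    + pDot 1 (u 0) (u 0) * sum_cDiag_mul_sq ω ε (u i)

theorem linearIndependent_sq {t δ : ℝ} (hδ : δ ≠ 0) {v : ℕ → Phase}
    (hv : ∀ i < 8, Step (stdFreq t) 1 (rescale δ (v i)) (rescale δ (v (i + 1))))
    (h₀ : ∀ i < 8, pDot 1 (rescale δ (v i)) (rescale δ (v i)) ≠ 0)
    (h : LinearIndependent ℝ (fun (j : Fin 6) (i : Fin 8) => adaptedFun t (δ ^ 2) v j i)) :
    LinearIndependent ℝ (fun (j : Fin 6) (i : Fin 8) => rescale δ (v i) j ^ 2) := by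
  -- It suffices that the six adapted functions lie in the span of the six squares, which then has
  -- dimension at least six.
  rw [linearIndependent_iff_card_le_finrank_span, ← finrank_span_eq_card h]
  refine Submodule.finrank_mono (Submodule.span_le.2 ?_)
  set F : Fin 6 → Fin 8 → ℝ := fun j i => rescale δ (v i) j ^ 2 with hF
  set S := Submodule.span ℝ (Set.range F)
  have hmem : ∀ j, F j ∈ S := fun j => Submodule.subset_span ⟨j, rfl⟩
  have hcomb : ∀ (c : Fin 6 → ℝ) (f : Fin 8 → ℝ), (∀ i, f i = c 0 * F 0 i + c 1 * F 1 i
      + c 2 * F 2 i + c 3 * F 3 i + c 4 * F 4 i + c 5 * F 5 i) → f ∈ S := by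
    intro c f hf
    have : f = ∑ j, c j • F j := by
      ext i
      simp [hf i, Fin.sum_univ_six]
    rw [this]
    exact Submodule.sum_mem _ fun j _ => Submodule.smul_mem _ _ (hmem j)
  -- The ratios C_k / p² are conserved and ∑ C_k p_k² = p², so the initial ratios express 1 through
  -- the squares of the p_k.
  have hone : (fun _ => 1 : Fin 8 → ℝ) ∈ S := by
    let c := cDiag (stdFreq t) 1 (rescale δ (v 0))
    let P := pDot 1 (rescale δ (v 0)) (rescale δ (v 0))
    have hP : P ≠ 0 := h₀ 0 (by norm_num)
    refine hcomb ![0, 0, 0, c 0 / P, c 1 / P, c 2 / P] _ fun i => ?_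
    have := sum_cDiag_mul_sq_of_step (u := fun i => rescale δ (v i)) hv h₀ i.2
    simp only [Matrix.cons_val_zero, Matrix.cons_val_one, Matrix.cons_val]
    change c 0 * F 3 i + c 1 * F 4 i + c 2 * F 5 i = P at this
    field_simp
    linear_combination -this
  have henergy : ∀ (C : Fin 3 → ℝ) (a b : ℝ), C 0 * (stdFreq t 2 - stdFreq t 1) = b - a →
      C 1 * (stdFreq t 0 - stdFreq t 2) = -b → C 2 * (stdFreq t 1 - stdFreq t 0) = a →
      (fun i : Fin 8 => ∑ l ∈ Finset.range i, energyIncr a b (δ ^ 2) (v l) (v (l + 1))) ∈ S := by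
    intro C a b h1 h2 h3
    let E : ℕ → ℝ := fun i => diagEnergy C ![0, a, b] (rescale δ (v i))
    have hE : (fun i : Fin 8 => E i) ∈ S :=
      hcomb ![C 0, C 1, C 2, 0, a, b] _ fun i => by
        simp only [E, F, diagEnergy, mDot, pDot, Matrix.cons_val_zero, Matrix.cons_val_one,
          Matrix.cons_val]
        ring
    have hsum : ∀ i ≤ 8, δ ^ 4 * ∑ l ∈ Finset.range i, energyIncr a b (δ ^ 2) (v l) (v (l + 1))
        = E i - E 0 := by
      intro i hi
      rw [Finset.mul_sum, ← Finset.sum_range_sub]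
      refine Finset.sum_congr rfl fun l hl => ?_
      rw [← energyIncr_rescale]
      exact ((hv l (by have := Finset.mem_range.1 hl; omega)).diagEnergy_sub h1 h2 h3).symm
    have : (fun i : Fin 8 => ∑ l ∈ Finset.range i, energyIncr a b (δ ^ 2) (v l) (v (l + 1)))
        = (δ ^ 4)⁻¹ • ((fun i : Fin 8 => E i) - E 0 • fun _ => 1) := by
      ext i
      have := hsum i i.2.le
      simp only [Pi.smul_apply, Pi.sub_apply, smul_eq_mul, mul_one, ← this]
      field_simp
    rw [this]
    exact Submodule.smul_mem _ _ (Submodule.sub_mem _ hE (Submodule.smul_mem _ _ hone))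
  rintro _ ⟨j, rfl⟩
  fin_cases j
  · exact hone
  · refine hcomb ![0, 0, 0, 0, (δ ^ 2)⁻¹, 0] _ fun i => ?_
    simp [adaptedFun, hF, rescale]
    field_simp
  · refine hcomb ![0, 0, 0, 0, 0, (δ ^ 2)⁻¹] _ fun i => ?_
    simp [adaptedFun, hF, rescale]
    field_simp
  · refine hcomb ![(δ ^ 4)⁻¹, 0, 0, 0, 0, 0] _ fun i => ?_
    simp [adaptedFun, hF, rescale]
    field_simp
  · refine henergy 1 (-1 / 4) (-t ^ 2) ?_ ?_ ?_ <;> simp [stdFreq]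
  · refine henergy (stdFreq t) (t ^ 2 / 4) (t ^ 2 / 4) ?_ ?_ ?_ <;> simp [stdFreq] <;> ring

theorem det_ne_zero_of_conj {A B : Matrix (Fin 6) (Fin 6) ℝ} {S : Phase → Phase}
    (hS : Function.Bijective S) (h₀ : S 0 = 0) (h : ∀ y, A *ᵥ S y = S (B *ᵥ y))
    (hB : B.det ≠ 0) : A.det ≠ 0 := by
  intro hA
  obtain ⟨z, hz, hz₀⟩ := Matrix.exists_mulVec_eq_zero_iff.2 hA
  obtain ⟨y, rfl⟩ := hS.2 z
  rw [h, ← h₀] at hz₀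
  refine hB (Matrix.exists_mulVec_eq_zero_iff.1 ⟨y, ?_, hS.1 hz₀⟩)
  rintro rfl
  exact hz h₀

theorem hasIndepOrbit_stdFreq {t : ℝ} (ht₀ : 0 < t) (ht : t < 1 / 2) :
    HasIndepOrbit (stdFreq t) 1 := by
  let w : ℕ → ℝ → Phase := rescaledOrbit t (limitOrbit t 0)
  have hdet : ∀ᶠ δ in nhds (0 : ℝ), ∀ i ∈ Finset.range 8,
      (rescaledMatrix t (δ ^ 2) (w i δ)).det ≠ 0 :=
    (Filter.eventually_all_finset _).2 fun i _ => eventually_det_rescaledOrbit ht₀ ht i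
  have hp : ∀ᶠ δ in nhds (0 : ℝ), ∀ i ∈ Finset.range 8, w i δ 3 ≠ 0 := by
    refine (Filter.eventually_all_finset _).2 fun i _ => ?_
    refine (continuousAt_pi.1 (continuousAt_rescaledOrbit ht₀ ht i) 3).eventually_ne ?_
    rw [rescaledOrbit_zero ht₀ ht]
    exact one_ne_zero
  have hev := (hdet.and (hp.and (eventually_linearIndependent_adaptedFun ht₀ ht))).filter_mono
    (nhdsWithin_le_nhds (s := {0}ᶜ))
  obtain ⟨δ, ⟨h1, h2, h3⟩, hδ⟩ := (hev.and self_mem_nhdsWithin).exists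
  have hδ0 : δ ≠ 0 := hδ
  have hstep : ∀ i < 8, kahanMatrix (stdFreq t) 1 (rescale δ (w i δ)) *ᵥ rescale δ (w (i + 1) δ)
      = rescale δ (w i δ) := fun i hi => by
    rw [kahanMatrix_mulVec_rescale]
    congr 1
    exact mulVec_det_inv_smul_adjugate (h1 i (Finset.mem_range.2 hi)) _
  refine ⟨fun i => rescale δ (w i δ), hstep, fun i hi h0 => ?_,
    linearIndependent_sq hδ0 (v := fun i => w i δ) (fun i hi => (step_iff _ _ _ _).2 (hstep i hi))
      (fun i hi => ?_) h3⟩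
  · refine det_ne_zero_of_conj (S := rescale δ) ⟨fun x y hxy => ?_, fun z => ?_⟩ ?_
      (fun y => kahanMatrix_mulVec_rescale t δ (w i δ) y) (h1 i (Finset.mem_range.2 hi)) h0
    · have k := fun j => congrFun hxy j
      ext j
      have := k j
      fin_cases j <;> simpa [rescale, hδ0] using this
    · refine ⟨![z 0 / δ ^ 2, z 1 / δ, z 2 / δ, z 3, z 4 / δ, z 5 / δ], ?_⟩
      ext j
      fin_cases j <;> simp [rescale] <;> field_simp
    · ext j
      fin_cases j <;> simp [rescale]
  · have := h2 i (Finset.mem_range.2 hi)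
    simp only [pDot, rescale, Pi.one_apply, Matrix.cons_val]
    have h4 := mul_self_pos.2 this
    nlinarith [mul_self_nonneg (δ * w i δ 4), mul_self_nonneg (δ * w i δ 5)]

/-! ### Reduction to the normalized frequencies -/

theorem HasIndepOrbit.transport {ω ω' : Fin 3 → ℝ} {ε ε' : ℝ} (h : HasIndepOrbit ω' ε')
    (c : Fin 6 → ℝ) (hc : ∀ i, c i ≠ 0) (e : Equiv.Perm (Fin 6))
    (hS : ∀ x y : Phase, kahanMatrix ω ε (fun i => c i * x (e i)) *ᵥ (fun i => c i * y (e i))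
      = fun i => c i * (kahanMatrix ω' ε' x *ᵥ y) (e i)) : HasIndepOrbit ω ε := by
  obtain ⟨u, hu, hdet, hli⟩ := h
  refine ⟨fun n i => c i * u n (e i), fun n hn => ?_, fun n hn => ?_, ?_⟩
  · rw [hS, hu n hn]
  · refine det_ne_zero_of_conj (S := fun y i => c i * y (e i)) ⟨fun x y hxy => ?_, fun z => ?_⟩ ?_
      (fun y => hS (u n) y) (hdet n hn)
    · ext i
      have := congrFun hxy (e.symm i)
      simpa [hc] using this
    · refine ⟨fun i => z (e.symm i) / c (e.symm i), ?_⟩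
      ext i
      simp [mul_div_cancel₀, hc]
    · ext i
      simp
  · have := (hli.comp e e.injective).units_smul (fun j => Units.mk0 (c j ^ 2) (pow_ne_zero 2 (hc j)))
    convert this using 2 with j
    ext i
    simp [Units.smul_def, mul_pow]

/-- The cyclic shift of the indices. -/
def cycPerm : Equiv.Perm (Fin 6) where
  toFun := ![1, 2, 0, 4, 5, 3]
  invFun := ![2, 0, 1, 5, 3, 4]
  left_inv := by decide
  right_inv := by decide

/-- The exchange of the last two indices. -/
def swapPerm : Equiv.Perm (Fin 6) where
  toFun := ![0, 2, 1, 3, 5, 4]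
  invFun := ![0, 2, 1, 3, 5, 4]
  left_inv := by decide
  right_inv := by decide

theorem HasIndepOrbit.cyc {ω : Fin 3 → ℝ} {ε : ℝ} (h : HasIndepOrbit ![ω 2, ω 0, ω 1] ε) :
    HasIndepOrbit ω ε := by
  refine h.transport 1 (fun _ => one_ne_zero) cycPerm fun x y => ?_
  ext i
  fin_cases i <;>
    simp [kahanMatrix, cycPerm, Matrix.mulVec, dotProduct, Fin.sum_univ_succ] <;> ring

/-- An odd permutation reverses vector products and the differences of the ω_k; changing the sign of
m compensates. -/
theorem HasIndepOrbit.swap {ω : Fin 3 → ℝ} {ε : ℝ} (h : HasIndepOrbit ![ω 0, ω 2, ω 1] ε) :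
    HasIndepOrbit ω ε := by
  refine h.transport ![-1, -1, -1, 1, 1, 1] (fun i => by fin_cases i <;> simp) swapPerm
    fun x y => ?_
  ext i
  fin_cases i <;>
    simp [kahanMatrix, swapPerm, Matrix.mulVec, dotProduct, Fin.sum_univ_succ] <;> ring

theorem hasIndepOrbit_of_lt {ω : Fin 3 → ℝ} {ε : ℝ} (hε : ε ≠ 0) (h₁ : ω 2 < ω 0)
    (h₂ : ω 1 < ω 2) : HasIndepOrbit ω ε := by
  obtain ⟨α, hα, hα'⟩ : ∃ α, 0 < α ∧ ω 1 = ω 0 - α ^ 2 :=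
    ⟨√(ω 0 - ω 1), Real.sqrt_pos.2 (by linarith), by rw [Real.sq_sqrt] <;> linarith⟩
  obtain ⟨β, hβ, hβ'⟩ : ∃ β, 0 < β ∧ ω 2 = ω 0 - β ^ 2 :=
    ⟨√(ω 0 - ω 2), Real.sqrt_pos.2 (by linarith), by rw [Real.sq_sqrt] <;> linarith⟩
  have hβα : β < α := by nlinarith
  have ht : β / (2 * α) < 1 / 2 := by
    rw [div_lt_div_iff₀ (by linarith) (by norm_num)]
    linarith
  have hα0 := hα.ne'
  -- Only differences of the ω_k matter. Scaling m by 1/ε and p by 1/(2εα) turns α² and β² into 1/4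
  -- and t².
  refine (hasIndepOrbit_stdFreq (t := β / (2 * α)) (by positivity) ht).transport
    ![1 / ε, 1 / ε, 1 / ε, 1 / (2 * ε * α), 1 / (2 * ε * α), 1 / (2 * ε * α)]
    (fun i => by fin_cases i <;> simp [hε, hα0]) (Equiv.refl _) fun x y => ?_
  ext i
  fin_cases i <;>
    simp [kahanMatrix, stdFreq, Matrix.mulVec, dotProduct, Fin.sum_univ_succ, hα', hβ'] <;>
    field_simp <;> ring

theorem hasIndepOrbit {ω : Fin 3 → ℝ} (hω : Function.Injective ω) {ε : ℝ} (hε : ε ≠ 0) :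
    HasIndepOrbit ω ε := by
  have h01 : ω 0 ≠ ω 1 := fun h => absurd (hω h) (by decide)
  have h12 : ω 1 ≠ ω 2 := fun h => absurd (hω h) (by decide)
  have h02 : ω 0 ≠ ω 2 := fun h => absurd (hω h) (by decide)
  have key : ∀ a b c : ℝ, b < a → c < a → b ≠ c → HasIndepOrbit ![a, b, c] ε := by
    intro a b c hb hc hbc
    rcases hbc.lt_or_gt with h | h
    · exact hasIndepOrbit_of_lt hε hc h
    · exact HasIndepOrbit.swap (hasIndepOrbit_of_lt hε hb h)
  have hω' : ω = ![ω 0, ω 1, ω 2] := by ext i; fin_cases i <;> rfl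
  rcases h01.lt_or_gt with h | h <;> rcases h12.lt_or_gt with h' | h' <;>
    rcases h02.lt_or_gt with h'' | h''
  · exact HasIndepOrbit.cyc (key _ _ _ h'' h' h01)
  · exact HasIndepOrbit.cyc (key _ _ _ (h.trans h') h' h01)
  · exact HasIndepOrbit.cyc (HasIndepOrbit.cyc (key _ _ _ h' h h02.symm))
  · exact HasIndepOrbit.cyc (HasIndepOrbit.cyc (key _ _ _ h' h h02.symm))
  · exact HasIndepOrbit.cyc (key _ _ _ h'' h' h01)
  · rw [hω']
    exact key _ _ _ h h'' h12
  · exact absurd (h'.trans h) h''.not_gt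
  · rw [hω']
    exact key _ _ _ h h'' h12

/-! ### Generic one-dimensionality of the null-space -/

theorem thetaVec_ne_zero (ω : Fin 3 → ℝ) (ε : ℝ) (x : Phase) : thetaVec ω ε x ≠ 0 := fun h0 => by
  have := congrFun h0 6
  simp [thetaVec, thetaVecOf] at this

theorem det_transpose_mul_self_ne_zero_iff {m n : Type*} [Fintype m] [Fintype n] [DecidableEq n]
    (R : Matrix m n ℝ) : (Rᵀ * R).det ≠ 0 ↔ ∀ v, R *ᵥ v = 0 → v = 0 := by
  rw [ne_eq, ← Matrix.exists_mulVec_eq_zero_iff]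
  push Not
  have h : ∀ v, (Rᵀ * R) *ᵥ v = 0 ↔ R *ᵥ v = 0 := fun v => by
    have := Matrix.conjTranspose_mul_self_mulVec_eq_zero R v
    rwa [Matrix.conjTranspose_eq_transpose_of_trivial] at this
  exact ⟨fun H v hv => by_contra fun h0 => H v h0 ((h v).2 hv),
    fun H v hv h0 => hv (H v ((h v).1 h0))⟩

/-- The squares of the numerators of the first eight iterates. -/
noncomputable def sqMatrix (ω : Fin 3 → ℝ) (ε : ℝ) : Matrix (Fin 8) (Fin 6) PhasePoly :=
  fun i j => (ratIter ω ε i).1 j ^ 2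

theorem eval_det_sqMatrix_ne_zero_iff (ω : Fin 3 → ℝ) (ε : ℝ) (x : Phase)
    (h : ∀ k < 8, iterDen ω ε k x ≠ 0) :
    MvPolynomial.eval x ((sqMatrix ω ε)ᵀ * sqMatrix ω ε).det ≠ 0 ↔
      ∀ v : Fin 6 → ℝ, (∀ i < 8, ∑ j, v j * iterVal ω ε i x j ^ 2 = 0) → v = 0 := by
  let R : Matrix (Fin 8) (Fin 6) ℝ := fun i j => iterNum ω ε i x j ^ 2
  have hR : MvPolynomial.eval x ((sqMatrix ω ε)ᵀ * sqMatrix ω ε).det = (Rᵀ * R).det := by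
    rw [RingHom.map_det]
    congr 1
    ext i j
    simp only [RingHom.mapMatrix_apply, Matrix.map_apply, Matrix.mul_apply, Matrix.transpose_apply,
      map_sum, map_mul, sqMatrix, map_pow]
    exact (Matrix.mul_apply (M := Rᵀ) (N := R)).symm
  rw [hR, det_transpose_mul_self_ne_zero_iff]
  have hv : ∀ v : Fin 6 → ℝ, R *ᵥ v = 0 ↔ ∀ i < 8, ∑ j, v j * iterVal ω ε i x j ^ 2 = 0 := by
    intro v
    have hi : ∀ i : Fin 8, (R *ᵥ v) i
        = iterDen ω ε i x ^ 2 * ∑ j, v j * iterVal ω ε i x j ^ 2 := fun i => by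
      have := h i i.2
      simp only [Matrix.mulVec, dotProduct, R, iterVal, Finset.mul_sum]
      refine Finset.sum_congr rfl fun j _ => ?_
      field_simp
    constructor
    · intro h0 i hi8
      have := congrFun h0 ⟨i, hi8⟩
      rw [hi] at this
      exact (mul_eq_zero.1 this).resolve_left (pow_ne_zero 2 (h i hi8))
    · intro h0
      ext i
      rw [hi, h0 i i.2, mul_zero]
      rfl
  simp only [hv]

theorem exists_poly_nullSpace_eq_span (ω : Fin 3 → ℝ) (hω : Function.Injective ω) {ε : ℝ}
    (hε : ε ≠ 0) :
    ∃ Q : PhasePoly, Q ≠ 0 ∧ ∀ x : Phase, MvPolynomial.eval x Q ≠ 0 →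
      pDot 1 x x ≠ 0 ∧ deltaVal ω ε x ≠ 0 ∧
      clebschNullSpace ω ε Theta x = Submodule.span ℝ {thetaVec ω ε x} := by
  obtain ⟨q, hq⟩ := exists_genericPoly ω ε
  obtain ⟨z, hz, -⟩ := exists_generic_fixedPoint ω hε
  have hq0 : q ≠ 0 := by
    rintro rfl
    exact (hq z).2 hz (map_zero _)
  obtain ⟨u, hu, hdet, hli⟩ := hasIndepOrbit hω hε
  have hiter : ∀ n < 8, u n ∈ iter (clebschMap ω ε) n (u 0) := by
    intro n hn
    induction n with
    | zero => exact (mem_iter_iff _ _ _ _ _).2 ⟨fun k hk => by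
        rw [Nat.le_zero.1 hk, iterDen_zero]; exact one_ne_zero, (iterVal_zero _ _ _).symm⟩
    | succ n ih =>
      have hn' := Nat.lt_of_succ_lt hn
      exact (mem_iter_succ _ _ _ _).2
        ⟨u n, ih hn', (mem_clebschMap _ _ _ _).2 ⟨hdet n hn', hu n hn'⟩⟩
  have hden : ∀ n < 8, iterDen ω ε n (u 0) ≠ 0 := fun n hn =>
    ((mem_iter_iff _ _ _ _ _).1 (hiter n hn)).1 n le_rfl
  have hval : ∀ n < 8, u n = iterVal ω ε n (u 0) := fun n hn =>
    ((mem_iter_iff _ _ _ _ _).1 (hiter n hn)).2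
  have hgram : MvPolynomial.eval (u 0) ((sqMatrix ω ε)ᵀ * sqMatrix ω ε).det ≠ 0 := by
    rw [eval_det_sqMatrix_ne_zero_iff ω ε _ hden]
    intro v hv
    refine funext (Fintype.linearIndependent_iff.1 hli v ?_)
    ext i
    rw [Finset.sum_apply]
    simpa only [Pi.smul_apply, smul_eq_mul, hval i i.2, Pi.zero_apply] using hv i i.2
  refine ⟨q * ((∏ k ∈ Finset.range 8, (ratIter ω ε k).2) *
    ((sqMatrix ω ε)ᵀ * sqMatrix ω ε).det), mul_ne_zero hq0 (mul_ne_zero ?_ ?_), fun x hx => ?_⟩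
  · refine Finset.prod_ne_zero_iff.2 fun k hk h0 => hden k (Finset.mem_range.1 hk) ?_
    rw [iterDen, h0, map_zero]
  · intro h0
    exact hgram (by rw [h0, map_zero])
  rw [map_mul, map_mul, map_prod] at hx
  have hxg := (hq x).1 (left_ne_zero_of_mul hx)
  have hxd : ∀ k < 8, iterDen ω ε k x ≠ 0 := fun k hk =>
    Finset.prod_ne_zero_iff.1 (left_ne_zero_of_mul (right_ne_zero_of_mul hx)) k
      (Finset.mem_range.2 hk)
  have hxG := (eval_det_sqMatrix_ne_zero_iff ω ε x hxd).1
    (right_ne_zero_of_mul (right_ne_zero_of_mul hx))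
  have hθ := thetaVec_mem ω hω hε x hxg.normSq hxg.delta
  refine ⟨hxg.normSq, hxg.delta, le_antisymm (fun c hc => ?_) ?_⟩
  · obtain ⟨c', hc'⟩ : ∃ c', c' = c + c 6 • thetaVec ω ε x := ⟨_, rfl⟩
    have hmem : c' ∈ clebschNullSpace ω ε Theta x :=
      hc' ▸ Submodule.add_mem _ hc (Submodule.smul_mem _ _ hθ)
    have hθ6 : thetaVec ω ε x 6 = -1 := rfl
    have h6 : c' 6 = 0 := by
      rw [hc', Pi.add_apply, Pi.smul_apply, hθ6, smul_eq_mul]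
      ring
    have hv := hxG ![c' 3, c' 4, c' 5, c' 0, c' 1, c' 2] fun i hi => by
      have := ((mem_clebschNullSpace_iff _ _ _ _ _).1 hmem).1 i (iterVal ω ε i x)
        ((mem_iter_iff _ _ _ _ _).2 ⟨fun k hk => hxd k (lt_of_le_of_lt hk hi), rfl⟩)
      rw [Fin.sum_univ_seven, h6] at this
      rw [Fin.sum_univ_six]
      simp only [Theta, Matrix.cons_val_zero, Matrix.cons_val_one, Matrix.cons_val] at this ⊢
      linear_combination this
    have hc0 : c' = 0 := by
      have k := fun j => congrFun hv j
      ext j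
      fin_cases j
      · exact k 3
      · exact k 4
      · exact k 5
      · exact k 0
      · exact k 1
      · exact k 2
      · exact h6
    rw [hc0] at hc'
    refine Submodule.mem_span_singleton.2 ⟨-c 6, ?_⟩
    rw [neg_smul]
    exact (eq_neg_of_add_eq_zero_left hc'.symm).symm
  · exact (Submodule.span_singleton_le_iff_mem _ _).2 hθ

end Clebsch

theorem mainTheorem5 (ω : Fin 3 → ℝ) (hω : Function.Injective ω) :
    ∃ (Δ : Fin 4 → PhasePoly) (d G : Fin 3 → Fin 4 → PhasePoly),
      -- the shape of `Δ`
      (∀ q, (Δ q).IsHomogeneous (2 + 2 * (q : ℕ))) ∧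
      Δ 0 = H₄ ∧
      Δ 1 = ∑ k, mVar k * pVar k * d2 ω k ∧
      -- `Δ` is the denominator of the coefficients `d₇, d₈, d₉` of the null-space of `Ψ`
      (∀ k q, (d k q).IsHomogeneous (2 * (q : ℕ))) ∧
      (∀ k, d k 0 = 1) ∧
      (∀ k, d k 1 = d2 ω k) ∧
      (∀ ε : ℝ, ε ≠ 0 → ∀ x : Phase, evenSum ε Δ x ≠ 0 →
        ![-1, -1, -1, dFun ε Δ d 0 x, dFun ε Δ d 1 x, dFun ε Δ d 2 x]
          ∈ clebschNullSpace ω ε Psi x) ∧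
      -- the shape of `g₁, g₂, g₃`
      (∀ k q, (G k q).IsHomogeneous (4 + 2 * (q : ℕ))) ∧
      (∀ k, G k 0 = 2 * H₄ ^ 2 - H₃ * H₁ ω + MvPolynomial.C (ω k) * H₃ ^ 2) ∧
      ∀ ε : ℝ, ε ≠ 0 →
        -- `Θ` is a Hirota–Kimura basis
        IsHKBasis (clebschMap ω ε) (clebschMap ω (-ε)) Theta ∧
        -- `g₁, …, g₆` are integrals
        (∀ j, IsIntegralOf (clebschMap ω ε) (gDom ε Δ) (fun x => gFun ω ε Δ G x j)) ∧
        -- the null-space contains `(g₁, …, g₆, -1)` at every point where this is defined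
        (∀ x ∈ gDom ε Δ,
          (Fin.snoc (gFun ω ε Δ G x) (-1) : Fin 7 → ℝ) ∈ clebschNullSpace ω ε Theta x) ∧
        -- and generically it is one-dimensional and spanned by this vector
        ∃ Q : PhasePoly, Q ≠ 0 ∧ ∀ x : Phase, MvPolynomial.eval x Q ≠ 0 →
          x ∈ gDom ε Δ ∧
          Module.finrank ℝ (clebschNullSpace ω ε Theta x) = 1 ∧
          clebschNullSpace ω ε Theta x
            = Submodule.span ℝ {(Fin.snoc (gFun ω ε Δ G x) (-1) : Fin 7 → ℝ)} := by
  refine ⟨deltaPoly ω, dPoly ω, gPoly ω, isHomogeneous_deltaPoly ω, deltaPoly_zero ω,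
    deltaPoly_one ω, isHomogeneous_dPoly ω, dPoly_zero ω, dPoly_one ω, fun ε hε x hx => ?_,
    isHomogeneous_gPoly ω, gPoly_zero ω, fun ε hε =>
      ⟨isHKBasis_Theta ω hω hε, fun j x hx y hxy hy => ?_, fun x hx => ?_, ?_⟩⟩
  · rw [evenSum_deltaPoly] at hx
    rw [dFun_eq, dFun_eq, dFun_eq]
    exact psiVec_mem ω hε x hx
  · rw [mem_gDom] at hx hy
    show gFun ω ε (deltaPoly ω) (gPoly ω) y j = gFun ω ε (deltaPoly ω) (gPoly ω) x j
    rw [← thetaVec_castSucc, ← thetaVec_castSucc]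
    exact thetaVec_eq ω hε x y hx.1 hx.2 hy.1 hy.2 hxy _
  · rw [mem_gDom] at hx
    rw [snoc_gFun]
    exact thetaVec_mem ω hω hε x hx.1 hx.2
  · obtain ⟨Q, hQ, h⟩ := exists_poly_nullSpace_eq_span ω hω hε
    refine ⟨Q, hQ, fun x hx => ?_⟩
    rw [mem_gDom, snoc_gFun]
    obtain ⟨h1, h2, h3⟩ := h x hx
    refine ⟨⟨h1, h2⟩, ?_, h3⟩
    rw [h3]
    exact finrank_span_singleton (thetaVec_ne_zero ω ε x)
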